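/- Let $\mathcal O$ be a discrete valuation ring with residue field $\mathbb K$ of characteristic different from $2$, fraction field $\mathcal K$ and projection $\mathrm{pr}:\mathcal O\to\mathbb K$. Let $A=A_{\bar 0}\oplus A_{\bar 1}$ be an $\mathcal O$-superalgebra (a $\mathbb Z/2$-graded associative unital algebra) that is free of finite rank over $\mathcal O$, and put $\mathbb KA=\mathbb K\otimes_{\mathcal O}A$, $\mathcal KA=\mathcal K\otimes_{\mathcal O}A$. **Conventions.** An $\mathcal O$-linear map $t:A\to\mathcal O$ is *evenly non-degenerate* if $t(A_{\bar 1})=0$ and $\det(t(b_1b_2))_{b_1,b_2\in B}\in\mathcal O^\times$ for some homogeneous basis $B$ of $A$. It is *symmetrizing* if moreover $t(xy)=t(yx)$ for all $x,y$, and *supersymmetrizing* if moreover $t(xy)=(-1)^{|x||y|}t(yx)$ for all homogeneous $x,y$. For a superalgebra over a field $k$, modules are finite-dimensional $\mathbb Z/2$-graded left modules, and a module is simple if it is nonzero and has no graded submodules except $0$ and itself. The superalgebra is *split* if every simple module $V$ stays simple under $k'\otimes_k-$ for every field extension $k'/k$. Endomorphisms of a module $V$ are the sums of homogeneous linear maps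 $f$ with $f(av)=(-1)^{|f||a|}af(v)$ for homogeneous $a$; a simple module is of *type M* if its endomorphism space is one-dimensional. A finite-dimensional superalgebra is *semisimple* if its usual (ungraded) Jacobson radical is zero. Extend $t$ to $t^{\mathcal K}=1\otimes t:\mathcal KA\to\mathcal K$, let $B$ be a homogeneous basis of $\mathcal KA$ and let $\{b^\vee\}$ be its dual basis, $t^{\mathcal K}(b^\vee b')=\delta_{b,b'}$. The Schur element $s_V\in\mathcal K$ of a simple $\mathcal KA$-module $V$ is determined by the following identities, required for all even $\mathcal K$-linear maps $f:V\to V$, all $v\in V$ and every choice of $B$: * if $t$ is symmetrizing: $\sum_{b\in B} b^\vee f(bv)=s_V\,\mathrm{tr}(f)\,v$; * if $t$ is supersymmetrizing and $V$ is of type M: $\sum_{b\in B}(-1)^{|b|}b^\vee f(bv)=s_V\,\mathrm{suptr}(f)\,v$, where $\mathrm{suptr}(f)=\mathrm{tr}(f|_{V_{\bar 0}})-\mathrm{tr}(f|_{V_{\bar 1}})$. **Theorem.** Suppose that $\mathbb KA$ and $\mathcal KA$ are split. 1. If $t$ is symmetrizing, then every simple $\mathcal KA$-module $V$ has a unique Schur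 element $s_V$, it lies in $\mathcal O$, and $\mathbb KA$ is semisimple if and only if $\mathrm{pr}(s_V)\neq 0$ for every simple $\mathcal KA$-module $V$. 2. If $t$ is supersymmetrizing, then every simple $\mathcal KA$-module $V$ of type M has a unique Schur element $s_V$, it lies in $\mathcal O$, and $\mathbb KA$ is semisimple if and only if every simple $\mathcal KA$-module is of type M and $\mathrm{pr}(s_V)\neq 0$ for every simple $\mathcal KA$-module $V$. -/

import Mathlib

open scoped TensorProduct

universe u v w

namespace SuperAlg

/-! Superalgebras over a commutative ring `R` are `R`-algebras `A` with a Mathlib `GradedAlgebra 𝒜`,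
where `𝒜 : ZMod 2 → Submodule R A`. For a ring map `R → S`, the superalgebra `S ⊗[R] A` is graded
by `baseChange S 𝒜`. -/

section Forms

variable {R : Type u} [CommRing R] {A : Type w} [Ring A] [Algebra R A]

/-- The grading `(S ⊗ A)_i = S ⊗ A_i` of the base change of a superalgebra. -/
abbrev baseChange (S : Type v) [CommRing S] [Algebra R S] (𝒜 : ZMod 2 → Submodule R A) :
    ZMod 2 → Submodule S (S ⊗[R] A) :=
  fun i => (𝒜 i).baseChange S

/-- The form `1 ⊗ t : S ⊗ A → S` obtained from `t : A → R`. -/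
noncomputable def baseChangeForm (S : Type v) [CommRing S] [Algebra R S] (t : A →ₗ[R] R) :
    (S ⊗[R] A) →ₗ[S] S :=
  (TensorProduct.AlgebraTensorModule.rid R S S).toLinearMap ∘ₗ t.baseChange S

/-- `b` is a `ℤ/2`-homogeneous basis, the basis vector `b i` having parity `p i`. -/
def IsHomogeneousBasis (𝒜 : ZMod 2 → Submodule R A) {n : ℕ}
    (b : Module.Basis (Fin n) R A) (p : Fin n → ZMod 2) : Prop :=
  ∀ i, b i ∈ 𝒜 (p i)

/-- `t` is evenly non-degenerate: it is even (zero on the odd part), and its Gram determinant with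
respect to some homogeneous basis is a unit. -/
structure IsEvenlyNondegenerate (𝒜 : ZMod 2 → Submodule R A) (t : A →ₗ[R] R) : Prop where
  even : ∀ a ∈ 𝒜 1, t a = 0
  nondegenerate : ∃ (n : ℕ) (b : Module.Basis (Fin n) R A) (p : Fin n → ZMod 2),
    IsHomogeneousBasis 𝒜 b p ∧ IsUnit (Matrix.of fun i j => t (b i * b j)).det

/-- Symmetrizing forms. -/
structure IsSymmetrizingForm (𝒜 : ZMod 2 → Submodule R A) (t : A →ₗ[R] R) : Prop
    extends IsEvenlyNondegenerate 𝒜 t where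
  symm : ∀ x y, t (x * y) = t (y * x)

/-- Supersymmetrizing forms: `t (x y) = (-1)^{|x||y|} t (y x)` for homogeneous `x`, `y`. -/
structure IsSupersymmetrizingForm (𝒜 : ZMod 2 → Submodule R A) (t : A →ₗ[R] R) : Prop
    extends IsEvenlyNondegenerate 𝒜 t where
  supersymm : ∀ (i j : ZMod 2), ∀ x ∈ 𝒜 i, ∀ y ∈ 𝒜 j,
    t (x * y) = (-1) ^ (i * j).val * t (y * x)

/-- `b'` is the dual basis of `b` with respect to `t`: `t (b'_i b_j) = δ_{ij}`. -/
def IsDualBasis (t : A →ₗ[R] R) {n : ℕ} (b : Module.Basis (Fin n) R A) (b' : Fin n → A) : Prop :=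
  ∀ i j, t (b' i * b j) = if i = j then 1 else 0

end Forms

/-- A finite-dimensional (`ℤ/2`-graded, left) module over the superalgebra `A` over the field `k`.
The action is given by the algebra map `ρ : A → End_k(V)`. The universe of `V` is large enough to
contain all quotients of `A` and all finite-dimensional `k`-spaces up to isomorphism. -/
structure SuperModule {k : Type u} [Field k] {A : Type w} [Ring A] [Algebra k A]
    (𝒜 : ZMod 2 → Submodule k A) where
  /-- the underlying space -/
  carrier : Type (max u w)
  [addCommGroup : AddCommGroup carrier]
  [module : Module k carrier]
  [finite : FiniteDimensional k carrier]
  /-- the homogeneous components -/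
  part : ZMod 2 → Submodule k carrier
  isInternal : DirectSum.IsInternal part
  /-- the action of `A` -/
  ρ : A →ₐ[k] Module.End k carrier
  ρ_mem : ∀ (i j : ZMod 2), ∀ a ∈ 𝒜 i, ∀ v ∈ part j, ρ a v ∈ part (i + j)

attribute [instance] SuperModule.addCommGroup SuperModule.module SuperModule.finite

namespace SuperModule

variable {k : Type u} [Field k] {A : Type w} [Ring A] [Algebra k A]
  {𝒜 : ZMod 2 → Submodule k A}

/-- `V` is simple: it is nonzero and its only `A`-stable graded subspaces are `0` and `V`. -/
def IsSimple (V : SuperModule 𝒜) : Prop :=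
  Nontrivial V.carrier ∧ ∀ W : Submodule k V.carrier,
    (∀ a, ∀ w ∈ W, V.ρ a w ∈ W) → W = (W ⊓ V.part 0) ⊔ (W ⊓ V.part 1) → W = ⊥ ∨ W = ⊤

/-- The action `(c ⊗ a) (d ⊗ v) = cd ⊗ av` of `K ⊗ A` on `K ⊗ V`. -/
noncomputable def extendAction (V : SuperModule 𝒜) (K : Type u) [Field K] [Algebra k K] :
    K ⊗[k] A →ₐ[K] Module.End K (K ⊗[k] V.carrier) :=
  Algebra.TensorProduct.lift (Algebra.ofId K (Module.End K (K ⊗[k] V.carrier)))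
    ((Module.End.baseChangeHom k K V.carrier).comp V.ρ)
    (fun x _ => by rw [Algebra.ofId_apply]; exact Algebra.commutes x _)

theorem extendAction_tmul (V : SuperModule 𝒜) (K : Type u) [Field K] [Algebra k K] (c d : K)
    (a : A) (v : V.carrier) :
    V.extendAction K (c ⊗ₜ[k] a) (d ⊗ₜ[k] v) = (c * d) ⊗ₜ[k] V.ρ a v := by
  rw [extendAction, Algebra.TensorProduct.lift_tmul, Module.End.mul_apply, Algebra.ofId_apply,
    Module.algebraMap_end_apply]
  change c • (d ⊗ₜ[k] V.ρ a v) = _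
  rw [TensorProduct.smul_tmul', smul_eq_mul]

theorem extendAction_mem (V : SuperModule 𝒜) (K : Type u) [Field K] [Algebra k K] (i j : ZMod 2)
    (a : K ⊗[k] A) (ha : a ∈ baseChange K 𝒜 i) (v : K ⊗[k] V.carrier)
    (hv : v ∈ (V.part j).baseChange K) :
    V.extendAction K a v ∈ (V.part (i + j)).baseChange K := by
  rw [baseChange, Submodule.baseChange_eq_span] at ha
  rw [Submodule.baseChange_eq_span] at hv
  induction ha using Submodule.span_induction with
  | zero => rw [map_zero]; exact zero_mem _
  | add x y _ _ hx hy => rw [map_add]; exact add_mem hx hy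
  | smul c x _ hx => rw [map_smul]; exact Submodule.smul_mem _ c hx
  | mem x hx =>
    obtain ⟨a, ha, rfl⟩ := hx
    induction hv using Submodule.span_induction with
    | zero => rw [map_zero]; exact zero_mem _
    | add x y _ _ hx hy => rw [map_add]; exact add_mem hx hy
    | smul c x _ hx => rw [map_smul]; exact Submodule.smul_mem _ c hx
    | mem y hy =>
      obtain ⟨v, hv, rfl⟩ := hy
      rw [TensorProduct.mk_apply, TensorProduct.mk_apply, extendAction_tmul]
      exact Submodule.tmul_mem_baseChange_of_mem _ (V.ρ_mem i j a ha v hv)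

theorem isInternal_baseChange_aux {k : Type u} [Field k] {M : Type v} [AddCommGroup M] [Module k M]
    {ι : Type} [DecidableEq ι] (P : ι → Submodule k M) (h : DirectSum.IsInternal P)
    (K : Type w) [Field K] [Algebra k K] :
    DirectSum.IsInternal fun j => (P j).baseChange K := by
  have := DirectSum.IsInternal.baseChange (S := K) P h
  exact this

theorem isInternal_baseChange (V : SuperModule 𝒜) (K : Type u) [Field K] [Algebra k K] :
    DirectSum.IsInternal fun j => (V.part j).baseChange K :=
  isInternal_baseChange_aux V.part V.isInternal K

/-- The `K ⊗ A`-supermodule `K ⊗ V`. -/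
noncomputable def extend (V : SuperModule 𝒜) (K : Type u) [Field K] [Algebra k K] :
    SuperModule (baseChange K 𝒜) where
  carrier := K ⊗[k] V.carrier
  part := fun j => (V.part j).baseChange K
  isInternal := isInternal_baseChange V K
  ρ := V.extendAction K
  ρ_mem := V.extendAction_mem K

/-- The homogeneous `A`-endomorphisms `f` of parity `p`:
`f (V_j) ⊆ V_{p+j}` and `f (a v) = (-1)^{|f||a|} a f (v)`. -/
def superEndPart (V : SuperModule 𝒜) (p : ZMod 2) : Submodule k (Module.End k V.carrier) where
  carrier := {f | (∀ j, ∀ v ∈ V.part j, f v ∈ V.part (p + j)) ∧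
    ∀ i, ∀ a ∈ 𝒜 i, ∀ v, f (V.ρ a v) = ((-1 : k) ^ (p * i).val) • V.ρ a (f v)}
  zero_mem' := by simp
  add_mem' := by
    rintro f g ⟨hf, hf'⟩ ⟨hg, hg'⟩
    refine ⟨fun j v hv => add_mem (hf j v hv) (hg j v hv), fun i a ha v => ?_⟩
    simp [hf' i a ha v, hg' i a ha v]
  smul_mem' := by
    rintro c f ⟨hf, hf'⟩
    refine ⟨fun j v hv => Submodule.smul_mem _ c (hf j v hv), fun i a ha v => ?_⟩
    simp [hf' i a ha v, smul_comm c]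

/-- The endomorphism (super)algebra of `V`, as a space. -/
def superEnd (V : SuperModule 𝒜) : Submodule k (Module.End k V.carrier) :=
  V.superEndPart 0 ⊔ V.superEndPart 1

/-- Type `M` (for a split simple module): the endomorphism algebra is one-dimensional. -/
def IsTypeM (V : SuperModule 𝒜) : Prop :=
  Module.finrank k V.superEnd = 1

/-- `f` is an even linear map. -/
def IsEven (V : SuperModule 𝒜) (f : Module.End k V.carrier) : Prop :=
  ∀ j, ∀ v ∈ V.part j, f v ∈ V.part j

theorem isCompl (V : SuperModule 𝒜) : IsCompl (V.part 0) (V.part 1) :=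
  V.isInternal.isCompl (by decide) (by
    ext i
    have : ∀ i : ZMod 2, i = 0 ∨ i = 1 := by decide
    simpa using this i)

/-- The supertrace: the trace of the block `V_0 → V_0` of `f` minus that of the block
`V_1 → V_1`. -/
noncomputable def superTrace (V : SuperModule 𝒜) (f : Module.End k V.carrier) : k :=
  LinearMap.trace k (V.part 0)
      ((V.part 0).projectionOnto (V.part 1) V.isCompl ∘ₗ f ∘ₗ (V.part 0).subtype) -
    LinearMap.trace k (V.part 1)
      ((V.part 1).projectionOnto (V.part 0) V.isCompl.symm ∘ₗ f ∘ₗ (V.part 1).subtype)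

/-- `s` is the Schur element of `V` with respect to a symmetrizing form `t`:
`I(f) = s tr(f) id_V` for all even `f`, where `I(f) v = ∑_b b^∨ f (b v)`; the homogeneous basis
is arbitrary. -/
def IsSchurElement (V : SuperModule 𝒜) (t : A →ₗ[k] k) (s : k) : Prop :=
  ∀ (n : ℕ) (b : Module.Basis (Fin n) k A) (p : Fin n → ZMod 2) (b' : Fin n → A),
    IsHomogeneousBasis 𝒜 b p → IsDualBasis t b b' →
      ∀ f : Module.End k V.carrier, V.IsEven f →
        ∀ v, ∑ i, V.ρ (b' i) (f (V.ρ (b i) v)) = (s * LinearMap.trace k V.carrier f) • v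

/-- `s` is the Schur element of `V` with respect to a supersymmetrizing form `t`:
`I(f) = s suptr(f) id_V` for all even `f`, where `I(f) v = ∑_b (-1)^{|b|} b^∨ f (b v)`; the
homogeneous basis is arbitrary. -/
def IsSuperSchurElement (V : SuperModule 𝒜) (t : A →ₗ[k] k) (s : k) : Prop :=
  ∀ (n : ℕ) (b : Module.Basis (Fin n) k A) (p : Fin n → ZMod 2) (b' : Fin n → A),
    IsHomogeneousBasis 𝒜 b p → IsDualBasis t b b' →
      ∀ f : Module.End k V.carrier, V.IsEven f →
        ∀ v, ∑ i, ((-1 : k) ^ (p i).val) • V.ρ (b' i) (f (V.ρ (b i) v)) =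
          (s * V.superTrace f) • v

end SuperModule

/-- The superalgebra `A` over the field `k` is split: every simple supermodule stays simple over
every extension field of `k`. -/
def IsSplit {k : Type u} [Field k] {A : Type w} [Ring A] [Algebra k A]
    (𝒜 : ZMod 2 → Submodule k A) : Prop :=
  ∀ V : SuperModule 𝒜, V.IsSimple →
    ∀ (K : Type u) [Field K] [Algebra k K], (V.extend K).IsSimple

/-- A (finite-dimensional) algebra is semisimple if its Jacobson radical, taken in the usual
non-super sense, is zero. -/
def IsSemisimple (A : Type w) [Ring A] : Prop :=
  Ring.jacobson A = ⊥

end SuperAlg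

/-! Both halves are one argument. Let `σ` be the identity in the symmetrizing case and the parity
automorphism in the supersymmetrizing case; then `t (x y) = t (y σ(x))`, because an even form pairs
only elements of equal parity. In any representation the average `I(f) = ∑ b^∨ f σ(b)` is
independent of the basis, commutes with `A` (`commute_average`), and is self-adjoint for `(f, g) ↦
tr(w f g)`, where `w` is `1` or the parity operator `P` (`trace_average`).

A simple module over `F` contains a lattice stable under `A` and `P` (`exists_integralForm`). By
Schur's lemma over a splitting field, averages of even `O`-matrices are scalars, so self-adjointness
gives `I(f) = s tr(w f)`. Since `2` is a unit, some even rank-one matrix has unit trace and unit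
supertrace; hence `s` lies in `O` and is unique (`exists_schur`). If the module is not of type `M`,
conjugation by an odd automorphism fixes scalar averages but negates the supertrace, so `s = 0` in
the supersymmetrizing case (`schur_eq_zero`).

If the reduction is semisimple, all its modules are projective, and Higman's criterion writes the
identity as an average (`exists_average_eq_one`). This is impossible when `s` reduces to `0`
(`residue_schur_ne_zero`).

Conversely, let all `s` be units and let `w ≠ 0` be a homogeneous element of the radical `J` of the
reduction. The `x` in `A` whose image kills `w` from the left form a proper graded left ideal `K`.
Among the graded left ideals of `F ⊗ A` there is a simple step at which the intersection with `A`
stops lying in `K` (`exists_simple_subquotient`). The unit Schur element makes the lattice of this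
step irreducible modulo the maximal ideal, so `x ↦ x w` embeds its reduction into `J`. Averaging a
rank-one operator then produces right multiplication by an element of `J` acting on this copy by a
nonzero scalar, which contradicts the nilpotence of `J` (`false_of_injective`). -/

namespace SuperAlg

/-! ### Casimir elements and averaging for twisted symmetric forms. -/

section Casimir

variable {R : Type*} [CommRing R] {A : Type*} [Ring A] [Algebra R A]

/-- `t (x y) = t (y σ(x))` for an involutive automorphism `σ`. -/
structure IsTwistedSymmetric (t : A →ₗ[R] R) (σ : A →ₐ[R] A) : Prop where
  involutive : ∀ x, σ (σ x) = x
  symm : ∀ x y, t (x * y) = t (y * σ x)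

theorem IsTwistedSymmetric.map_eq {t : A →ₗ[R] R} {σ : A →ₐ[R] A} (h : IsTwistedSymmetric t σ)
    (x : A) : t (σ x) = t x := by
  have := h.symm x 1
  simpa using this.symm

theorem IsTwistedSymmetric.symm' {t : A →ₗ[R] R} {σ : A →ₐ[R] A} (h : IsTwistedSymmetric t σ)
    (x y : A) : t (x * σ y) = t (y * x) :=
  (h.symm y x).symm

theorem IsTwistedSymmetric.mul_map {t : A →ₗ[R] R} {σ : A →ₐ[R] A} (h : IsTwistedSymmetric t σ)
    (x y : A) : t (x * σ y) = t (σ x * y) := by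
  rw [← h.map_eq, map_mul, h.involutive]

variable {t : A →ₗ[R] R} {σ : A →ₐ[R] A}

section Dual

variable {n : ℕ} {b : Module.Basis (Fin n) R A} {b' : Fin n → A}

theorem IsDualBasis.sum_smul_basis (hd : IsDualBasis t b b') (x : A) :
    ∑ i, t (b' i * x) • b i = x := by
  have key : (∑ i, ((t ∘ₗ LinearMap.mulLeft R (b' i)).smulRight (b i))) = LinearMap.id := by
    refine b.ext fun j => ?_
    simp [hd _ j]
  simpa using congrArg (fun f : A →ₗ[R] A => f x) key

/-- The difference of the two sides pairs to zero with everything on the right. Twisted symmetry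
turns this into vanishing of all coordinates of its image under `σ`, and `σ` is injective. -/
theorem IsDualBasis.sum_smul_dual (hd : IsDualBasis t b b') (ht : IsTwistedSymmetric t σ) (x : A) :
    ∑ i, t (x * b i) • b' i = x := by
  set y := x - ∑ i, t (x * b i) • b' i with hy
  have h1 : ∀ j, t (y * b j) = 0 := fun j => by
    simp [hy, sub_mul, Finset.sum_mul, hd _ j]
  have h2 : ∀ z, t (y * z) = 0 := fun z => by
    have key : t ∘ₗ LinearMap.mulLeft R y = 0 := b.ext fun j => by simpa using h1 j
    simpa using congrArg (fun f : A →ₗ[R] R => f z) key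
  have h3 : σ y = 0 := by
    rw [← hd.sum_smul_basis (σ y)]
    exact Finset.sum_eq_zero fun i _ => by rw [ht.symm', h2, zero_smul]
  have h4 : y = 0 := by rw [← ht.involutive y, h3, map_zero]
  exact (sub_eq_zero.mp h4).symm

/-- Basis independence of the Casimir element `∑ b^∨ ⊗ b`, tested on bilinear maps: expanding one
basis in the other produces the same double sum from both sides. -/
theorem IsDualBasis.sum_bilin_eq (hd : IsDualBasis t b b') (ht : IsTwistedSymmetric t σ)
    {m : ℕ} {c : Module.Basis (Fin m) R A} {c' : Fin m → A} (hc : IsDualBasis t c c')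
    {M : Type*} [AddCommGroup M] [Module R M] (B : A →ₗ[R] A →ₗ[R] M) :
    ∑ i, B (b' i) (b i) = ∑ j, B (c' j) (c j) := by
  have h1 : ∀ i, B (b' i) (b i) = ∑ j, t (c' j * b i) • B (b' i) (c j) := fun i => by
    conv_lhs => rw [← hc.sum_smul_basis (b i)]
    simp
  have h2 : ∀ j, B (c' j) (c j) = ∑ i, t (c' j * b i) • B (b' i) (c j) := fun j => by
    conv_lhs => rw [← hd.sum_smul_dual ht (c' j)]
    simp
  simp_rw [h1, h2]
  exact Finset.sum_comm

theorem IsDualBasis.map (hd : IsDualBasis t b b') (γ : A ≃ₐ[R] A) (hγ : ∀ x, t (γ x) = t x) :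
    IsDualBasis t (b.map γ.toLinearEquiv) (fun i => γ (b' i)) := fun i j => by
  simpa [← map_mul, hγ] using hd i j

/-- The Casimir element is symmetric up to `σ`. Both sides expand in `b^∨ ⊗ b^∨` with the Gram
matrix as coefficients. -/
theorem IsDualBasis.sum_bilin_swap (hd : IsDualBasis t b b') (ht : IsTwistedSymmetric t σ)
    {M : Type*} [AddCommGroup M] [Module R M] (B : A →ₗ[R] A →ₗ[R] M) :
    ∑ i, B (b i) (b' i) = ∑ i, B (b' i) (σ (b i)) := by
  have h1 : ∀ i, B (b i) (b' i) = ∑ j, t (b i * b j) • B (b' j) (b' i) := fun i => by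
    conv_lhs => rw [← hd.sum_smul_dual ht (b i)]
    simp
  have h2 : ∀ j, B (b' j) (σ (b j)) = ∑ i, t (b i * b j) • B (b' j) (b' i) := fun j => by
    conv_lhs => rw [← hd.sum_smul_dual ht (σ (b j))]
    simp [← ht.mul_map, ht.symm']
  simp_rw [h1, h2]
  exact Finset.sum_comm

/-- A dual basis exists when the Gram matrix is invertible. -/
theorem exists_isDualBasis (b : Module.Basis (Fin n) R A)
    (h : IsUnit (Matrix.of fun i j => t (b i * b j)).det) : ∃ b', IsDualBasis t b b' := by
  set G : Matrix (Fin n) (Fin n) R := Matrix.of fun i j => t (b i * b j) with hG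
  refine ⟨fun i => ∑ k, G⁻¹ i k • b k, fun i j => ?_⟩
  have := congrFun (congrFun (Matrix.nonsing_inv_mul G h) i) j
  rw [Matrix.mul_apply, Matrix.one_apply] at this
  rw [← this]
  simp [Finset.sum_mul, hG]

end Dual

section Averaging

variable {E : Type*} [Ring E] [Algebra R E] (ρ : A →ₐ[R] E) (σ)

/-- The bilinear map `(x, y) ↦ x f σ(y)`. -/
def sandwich (f : E) : A →ₗ[R] A →ₗ[R] E :=
  LinearMap.mk₂ R (fun x y => ρ x * f * ρ (σ y)) (by intros; simp [add_mul])
    (by intros; simp) (by intros; simp [mul_add]) (by intros; simp)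

/-- The averaging operator `f ↦ ∑_b b^∨ f σ(b)`. -/
def average {n : ℕ} (b b' : Fin n → A) (f : E) : E := ∑ i, ρ (b' i) * f * ρ (σ (b i))

variable {σ} {n : ℕ} {b : Module.Basis (Fin n) R A} {b' : Fin n → A}

theorem average_add (b b' : Fin n → A) (f g : E) :
    average σ ρ b b' (f + g) = average σ ρ b b' f + average σ ρ b b' g := by
  simp [average, mul_add, add_mul, Finset.sum_add_distrib]

theorem average_smul {S : Type*} [CommRing S] [Algebra S E] (b b' : Fin n → A) (c : S) (f : E) :
    average σ ρ b b' (c • f) = c • average σ ρ b b' f := by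
  simp [average, Finset.smul_sum]

theorem average_eq_of_isDualBasis (ht : IsTwistedSymmetric t σ) (hd : IsDualBasis t b b')
    {m : ℕ} {c : Module.Basis (Fin m) R A} {c' : Fin m → A} (hc : IsDualBasis t c c') (f : E) :
    average σ ρ b b' f = average σ ρ c c' f :=
  hd.sum_bilin_eq ht hc (sandwich σ ρ f)

/-- Left multiplication by `a` on the `b^∨` and right multiplication by `a` on the `σ(b)` have
transposed matrices, with entries `t (a b_i^∨ b_j)`; twisted symmetry identifies them. -/
theorem commute_average (ht : IsTwistedSymmetric t σ) (hd : IsDualBasis t b b') (f : E) (a : A) :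
    Commute (ρ a) (average σ ρ b b' f) := by
  have h1 : ∀ i, ρ a * (ρ (b' i) * f * ρ (σ (b i))) =
      ∑ j, t (a * b' i * b j) • (ρ (b' j) * f * ρ (σ (b i))) := fun i => by
    rw [← mul_assoc, ← mul_assoc, ← map_mul]
    conv_lhs => rw [← hd.sum_smul_dual ht (a * b' i)]
    simp [Finset.sum_mul]
  have h2 : ∀ j, ρ (b' j) * f * ρ (σ (b j)) * ρ a =
      ∑ i, t (a * b' i * b j) • (ρ (b' j) * f * ρ (σ (b i))) := fun j => by
    rw [mul_assoc, ← map_mul, ← ht.involutive a, ← map_mul,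
      ← hd.sum_smul_basis (b j * σ a)]
    simp [Finset.mul_sum, ht.involutive, ← mul_assoc, ht.symm']
  rw [commute_iff_eq, average, Finset.mul_sum, Finset.sum_mul]
  simp_rw [h1, h2]
  exact Finset.sum_comm

/-- The averaging operator is compatible with conjugation by `T`, where `T a = γ(a) T`. -/
theorem average_conj (ht : IsTwistedSymmetric t σ) (hd : IsDualBasis t b b') (γ : A ≃ₐ[R] A)
    (hγ : ∀ x, t (γ x) = t x) (hσγ : ∀ x, σ (γ x) = γ (σ x)) {T T' : E}
    (hT : ∀ a, T * ρ a = ρ (γ a) * T) (hT' : ∀ a, T' * ρ (γ a) = ρ a * T') (f : E) :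
    average σ ρ b b' (T * f * T') = T * average σ ρ b b' f * T' := by
  -- As `γ` preserves `t`, it carries the dual pair to another dual pair, with the same average.
  rw [average_eq_of_isDualBasis ρ ht hd (hd.map γ hγ)]
  simp only [average, Finset.mul_sum, Finset.sum_mul]
  refine Finset.sum_congr rfl fun i _ => ?_
  simp only [Module.Basis.map_apply, AlgEquiv.toLinearEquiv_apply, hσγ]
  calc ρ (γ (b' i)) * (T * f * T') * ρ (γ (σ (b i)))
      = (ρ (γ (b' i)) * T) * f * (T' * ρ (γ (σ (b i)))) := by simp only [mul_assoc]
    _ = _ := by rw [← hT, hT']; simp only [mul_assoc]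

/-- Self-adjointness of averaging. Cyclicity of `τ` moves `σ(b)` to the front, `w` absorbs the
twist, and `sum_bilin_swap` exchanges the roles of `b` and `b^∨`. -/
theorem trace_average (ht : IsTwistedSymmetric t σ) (hd : IsDualBasis t b b')
    (τ : E →ₗ[R] R) (hτ : ∀ x y, τ (x * y) = τ (y * x)) (w : E)
    (hw : ∀ a, w * ρ a = ρ (σ a) * w) (f g : E) :
    τ (w * f * average σ ρ b b' g) = τ (w * average σ ρ b b' f * g) := by
  have key := hd.sum_bilin_swap ht (LinearMap.mk₂ R (fun x y => τ (w * ρ x * f * ρ y * g))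
    (by intros; simp [add_mul, mul_add]) (by intros; simp)
    (by intros; simp [add_mul, mul_add]) (by intros; simp))
  simp only [LinearMap.mk₂_apply] at key
  simp only [average, Finset.mul_sum, Finset.sum_mul, map_sum]
  simp only [← mul_assoc]
  rw [← key]
  refine Finset.sum_congr rfl fun i _ => ?_
  rw [hτ, hw]
  simp only [← mul_assoc]

end Averaging

end Casimir

/-! ### The parity automorphism, and supersymmetry as a twist by it. -/

section Parity

variable {R : Type*} [CommRing R] {A : Type*} [Ring A] [Algebra R A]

/-- `γ` is the parity automorphism `a ↦ (-1)^{|a|} a` of the superalgebra `A = A_0 + A_1`. -/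
structure IsParity (𝒜 : ZMod 2 → Submodule R A) (γ : A ≃ₐ[R] A) : Prop where
  even : ∀ a ∈ 𝒜 0, γ a = a
  odd : ∀ a ∈ 𝒜 1, γ a = -a
  sup_eq_top : 𝒜 0 ⊔ 𝒜 1 = ⊤

namespace IsParity

variable {𝒜 : ZMod 2 → Submodule R A} {γ : A ≃ₐ[R] A}

theorem exists_add (h : IsParity 𝒜 γ) (x : A) : ∃ y ∈ 𝒜 0, ∃ z ∈ 𝒜 1, x = y + z := by
  have hx : x ∈ 𝒜 0 ⊔ 𝒜 1 := h.sup_eq_top ▸ Submodule.mem_top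
  obtain ⟨y, hy, z, hz, rfl⟩ := Submodule.mem_sup.mp hx
  exact ⟨y, hy, z, hz, rfl⟩

theorem involutive (h : IsParity 𝒜 γ) (x : A) : γ (γ x) = x := by
  obtain ⟨y, hy, z, hz, rfl⟩ := h.exists_add x
  simp [h.even y hy, h.odd z hz]

theorem apply_of_mem (h : IsParity 𝒜 γ) {i : ZMod 2} {a : A} (ha : a ∈ 𝒜 i) :
    γ a = ((-1 : R) ^ i.val) • a := by
  have hi : i = 0 ∨ i = 1 := by clear ha; revert i; decide
  obtain rfl | rfl := hi
  · simpa using h.even a ha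
  · simpa [ZMod.val_one] using h.odd a ha

theorem form_eq (h : IsParity 𝒜 γ) {t : A →ₗ[R] R} (ht : ∀ a ∈ 𝒜 1, t a = 0) (x : A) :
    t (γ x) = t x := by
  obtain ⟨y, hy, z, hz, rfl⟩ := h.exists_add x
  simp [h.even y hy, h.odd z hz, ht z hz]

end IsParity

theorem IsSymmetrizingForm.isTwistedSymmetric {𝒜 : ZMod 2 → Submodule R A} {t : A →ₗ[R] R}
    (h : IsSymmetrizingForm 𝒜 t) : IsTwistedSymmetric t (AlgHom.id R A) :=
  ⟨fun _ => rfl, h.symm⟩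

/-- Mixed products are odd and are killed by `t`; on elements of equal parity the sign
`(-1)^{|x||y|}` is `(-1)^{|x|}`, which is the effect of `γ` on `x`. -/
theorem IsSupersymmetrizingForm.isTwistedSymmetric {𝒜 : ZMod 2 → Submodule R A}
    [SetLike.GradedMonoid 𝒜] {γ : A ≃ₐ[R] A} (hγ : IsParity 𝒜 γ) {t : A →ₗ[R] R}
    (h : IsSupersymmetrizingForm 𝒜 t) : IsTwistedSymmetric t (γ : A →ₐ[R] A) := by
  refine ⟨hγ.involutive, fun x y => ?_⟩
  obtain ⟨x0, hx0, x1, hx1, rfl⟩ := hγ.exists_add x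
  obtain ⟨y0, hy0, y1, hy1, rfl⟩ := hγ.exists_add y
  have h00 := h.supersymm 0 0 x0 hx0 y0 hy0
  have h11 := h.supersymm 1 1 x1 hx1 y1 hy1
  have h01 := h.even _ (SetLike.GradedMul.mul_mem hx0 hy1)
  have h10 := h.even _ (SetLike.GradedMul.mul_mem hx1 hy0)
  have h01' := h.even _ (SetLike.GradedMul.mul_mem hy0 hx1)
  have h10' := h.even _ (SetLike.GradedMul.mul_mem hy1 hx0)
  have e : ((1 : ZMod 2) * 1).val = 1 := by decide
  rw [e] at h11
  simp only [mul_zero, ZMod.val_zero, pow_zero, one_mul, pow_one, neg_mul] at h00 h11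
  simp [mul_add, add_mul, hγ.even x0 hx0, hγ.odd x1 hx1, h00, h11, h01, h10, h01', h10']

theorem IsParity.baseChange {𝒜 : ZMod 2 → Submodule R A}
    (S : Type*) [CommRing S] [Algebra R S] {γ : A ≃ₐ[R] A}
    (h : IsParity 𝒜 γ) :
    IsParity (baseChange S 𝒜) (Algebra.TensorProduct.congr AlgEquiv.refl γ) := by
  refine ⟨fun x hx => ?_, fun x hx => ?_, ?_⟩
  · rw [SuperAlg.baseChange, Submodule.baseChange_eq_span] at hx
    induction hx using Submodule.span_induction with
    | zero => simp
    | add x y _ _ hx hy => rw [map_add, hx, hy]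
    | smul c x _ hx => rw [map_smul, hx]
    | mem x hx =>
      obtain ⟨a, ha, rfl⟩ := hx
      simp [h.even a ha]
  · rw [SuperAlg.baseChange, Submodule.baseChange_eq_span] at hx
    induction hx using Submodule.span_induction with
    | zero => simp
    | add x y _ _ hx hy => rw [map_add, hx, hy, neg_add]
    | smul c x _ hx => rw [map_smul, hx, smul_neg]
    | mem x hx =>
      obtain ⟨a, ha, rfl⟩ := hx
      simp [h.odd a ha, TensorProduct.tmul_neg]
  · refine eq_top_iff.mpr fun x _ => ?_
    induction x using TensorProduct.induction_on with
    | zero => exact zero_mem _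
    | add x y hx hy => exact add_mem (hx trivial) (hy trivial)
    | tmul c a =>
      obtain ⟨y, hy, z, hz, rfl⟩ := h.exists_add a
      rw [TensorProduct.tmul_add]
      exact add_mem (Submodule.mem_sup_left (Submodule.tmul_mem_baseChange_of_mem c hy))
        (Submodule.mem_sup_right (Submodule.tmul_mem_baseChange_of_mem c hz))

variable (𝒜 : ZMod 2 → Submodule R A) [GradedAlgebra 𝒜]

theorem sup_eq_top : 𝒜 0 ⊔ 𝒜 1 = ⊤ :=
  ((DirectSum.Decomposition.isInternal 𝒜).isCompl (i := 0) (j := 1) (by decide) (by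
    ext i
    have : ∀ i : ZMod 2, i = 0 ∨ i = 1 := by decide
    simpa using this i)).sup_eq_top

/-- The linear map `a ↦ a_0 - a_1`. -/
noncomputable def parityLinear : A →ₗ[R] A := GradedAlgebra.proj 𝒜 0 - GradedAlgebra.proj 𝒜 1

theorem parityLinear_even {a : A} (ha : a ∈ 𝒜 0) : parityLinear 𝒜 a = a := by
  simp [parityLinear, GradedAlgebra.proj_apply, DirectSum.decompose_of_mem_same 𝒜 ha,
    DirectSum.decompose_of_mem_ne 𝒜 ha (show (0 : ZMod 2) ≠ 1 by decide)]

theorem parityLinear_odd {a : A} (ha : a ∈ 𝒜 1) : parityLinear 𝒜 a = -a := by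
  simp [parityLinear, GradedAlgebra.proj_apply, DirectSum.decompose_of_mem_same 𝒜 ha,
    DirectSum.decompose_of_mem_ne 𝒜 ha (show (1 : ZMod 2) ≠ 0 by decide)]

theorem exists_add_of_graded (x : A) : ∃ y ∈ 𝒜 0, ∃ z ∈ 𝒜 1, x = y + z := by
  have hx : x ∈ 𝒜 0 ⊔ 𝒜 1 := sup_eq_top 𝒜 ▸ Submodule.mem_top
  obtain ⟨y, hy, z, hz, rfl⟩ := Submodule.mem_sup.mp hx
  exact ⟨y, hy, z, hz, rfl⟩

theorem parityLinear_mul (x y : A) :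
    parityLinear 𝒜 (x * y) = parityLinear 𝒜 x * parityLinear 𝒜 y := by
  obtain ⟨x0, hx0, x1, hx1, rfl⟩ := exists_add_of_graded 𝒜 x
  obtain ⟨y0, hy0, y1, hy1, rfl⟩ := exists_add_of_graded 𝒜 y
  have h00 := parityLinear_even 𝒜 (SetLike.GradedMul.mul_mem hx0 hy0)
  have h11 := parityLinear_even 𝒜 (SetLike.GradedMul.mul_mem hx1 hy1)
  have h01 := parityLinear_odd 𝒜 (SetLike.GradedMul.mul_mem hx0 hy1)
  have h10 := parityLinear_odd 𝒜 (SetLike.GradedMul.mul_mem hx1 hy0)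
  simp [mul_add, add_mul, h00, h01, h10, h11, parityLinear_even 𝒜 hx0, parityLinear_even 𝒜 hy0,
    parityLinear_odd 𝒜 hx1, parityLinear_odd 𝒜 hy1, add_comm]

theorem parityLinear_involutive (x : A) : parityLinear 𝒜 (parityLinear 𝒜 x) = x := by
  obtain ⟨x0, hx0, x1, hx1, rfl⟩ := exists_add_of_graded 𝒜 x
  simp [parityLinear_even 𝒜 hx0, parityLinear_odd 𝒜 hx1]

/-- The parity automorphism of a superalgebra. -/
noncomputable def parity : A ≃ₐ[R] A :=
  AlgEquiv.ofLinearEquiv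
    (LinearEquiv.ofInvolutive (parityLinear 𝒜) (parityLinear_involutive 𝒜))
    (parityLinear_even 𝒜 SetLike.GradedOne.one_mem) (parityLinear_mul 𝒜)

theorem isParity_parity : IsParity 𝒜 (parity 𝒜) :=
  ⟨fun _ => parityLinear_even 𝒜, fun _ => parityLinear_odd 𝒜, sup_eq_top 𝒜⟩

end Parity

/-! ### Parity operators and Schur's lemma. -/

namespace SuperModule

variable {k : Type u} [Field k] {A : Type w} [Ring A] [Algebra k A]
  {𝒜 : ZMod 2 → Submodule k A} (V : SuperModule 𝒜)

theorem exists_add (v : V.carrier) : ∃ x ∈ V.part 0, ∃ y ∈ V.part 1, v = x + y := by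
  have hx : v ∈ V.part 0 ⊔ V.part 1 := V.isCompl.sup_eq_top ▸ Submodule.mem_top
  obtain ⟨y, hy, z, hz, rfl⟩ := Submodule.mem_sup.mp hx
  exact ⟨y, hy, z, hz, rfl⟩

/-- The parity operator of a supermodule: `1` on the even part and `-1` on the odd part. -/
noncomputable def parityOp : Module.End k V.carrier :=
  (V.part 0).subtype ∘ₗ (V.part 0).projectionOnto (V.part 1) V.isCompl -
    (V.part 1).subtype ∘ₗ (V.part 1).projectionOnto (V.part 0) V.isCompl.symm

theorem parityOp_even {v : V.carrier} (hv : v ∈ V.part 0) : V.parityOp v = v := by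
  have h1 := Submodule.projectionOnto_apply_left V.isCompl ⟨v, hv⟩
  have h2 := Submodule.projectionOnto_apply_right V.isCompl.symm ⟨v, hv⟩
  simp only at h1 h2
  simp [parityOp, h1, h2]

theorem parityOp_odd {v : V.carrier} (hv : v ∈ V.part 1) : V.parityOp v = -v := by
  have h1 := Submodule.projectionOnto_apply_left V.isCompl.symm ⟨v, hv⟩
  have h2 := Submodule.projectionOnto_apply_right V.isCompl ⟨v, hv⟩
  simp only at h1 h2
  simp [parityOp, h1, h2]

theorem parityOp_mul_self : V.parityOp * V.parityOp = 1 := by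
  ext v
  obtain ⟨x, hx, y, hy, rfl⟩ := V.exists_add v
  simp [V.parityOp_even hx, V.parityOp_odd hy]

theorem parityOp_mul_rho {γ : A ≃ₐ[k] A} (h : IsParity 𝒜 γ) (a : A) :
    V.parityOp * V.ρ a = V.ρ (γ a) * V.parityOp := by
  ext v
  obtain ⟨x, hx, y, hy, rfl⟩ := V.exists_add v
  obtain ⟨a, ha, b, hb, rfl⟩ := h.exists_add a
  have h1 := V.parityOp_even (V.ρ_mem 0 0 a ha x hx)
  have h2 := V.parityOp_odd (V.ρ_mem 0 1 a ha y hy)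
  have h3 := V.parityOp_odd (V.ρ_mem 1 0 b hb x hx)
  have h4 := V.parityOp_even (V.ρ_mem 1 1 b hb y hy)
  simp [V.parityOp_even hx, V.parityOp_odd hy, h.even a ha, h.odd b hb, h1, h2, h3, h4,
    add_comm]

/-- This makes the supertrace the trace form twisted by `w = parityOp`, the shape that
`trace_average` requires. -/
theorem superTrace_eq (f : Module.End k V.carrier) :
    V.superTrace f = LinearMap.trace k V.carrier (V.parityOp * f) := by
  rw [superTrace, parityOp, sub_mul, map_sub]
  congr 1
  · rw [← LinearMap.comp_assoc, LinearMap.trace_comp_comm', ← LinearMap.comp_assoc]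
    rfl
  · rw [← LinearMap.comp_assoc, LinearMap.trace_comp_comm', ← LinearMap.comp_assoc]
    rfl

variable {V} in
theorem IsEven.commute {f : Module.End k V.carrier} (hf : V.IsEven f) : Commute V.parityOp f := by
  ext v
  obtain ⟨x, hx, y, hy, rfl⟩ := V.exists_add v
  simp [V.parityOp_even hx, V.parityOp_odd hy, V.parityOp_even (hf 0 x hx),
    V.parityOp_odd (hf 1 y hy)]

variable {V} in
theorem mem_part_zero_iff (h2 : (2 : k) ≠ 0) {v : V.carrier} :
    v ∈ V.part 0 ↔ V.parityOp v = v := by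
  refine ⟨V.parityOp_even, fun h => ?_⟩
  obtain ⟨x, hx, y, hy, rfl⟩ := V.exists_add v
  rw [map_add, V.parityOp_even hx, V.parityOp_odd hy, add_right_inj, neg_eq_iff_add_eq_zero,
    ← two_smul k, smul_eq_zero_iff_right h2] at h
  simpa [h] using hx

variable {V} in
theorem mem_part_one_iff (h2 : (2 : k) ≠ 0) {v : V.carrier} :
    v ∈ V.part 1 ↔ V.parityOp v = -v := by
  refine ⟨V.parityOp_odd, fun h => ?_⟩
  obtain ⟨x, hx, y, hy, rfl⟩ := V.exists_add v
  rw [map_add, V.parityOp_even hx, V.parityOp_odd hy, neg_add, add_left_inj, eq_comm,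
    neg_eq_iff_add_eq_zero, ← two_smul k, smul_eq_zero_iff_right h2] at h
  simpa [h] using hy

variable {V} in
theorem isEven_of_commute (h2 : (2 : k) ≠ 0) {f : Module.End k V.carrier}
    (hf : Commute V.parityOp f) : V.IsEven f := by
  have h (v : V.carrier) : V.parityOp (f v) = f (V.parityOp v) :=
    congrArg (fun g : Module.End k V.carrier => g v) hf.eq
  have h0 : ∀ v ∈ V.part 0, f v ∈ V.part 0 := fun v hv => by
    rw [mem_part_zero_iff h2, h, V.parityOp_even hv]
  have h1 : ∀ v ∈ V.part 1, f v ∈ V.part 1 := fun v hv => by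
    rw [mem_part_one_iff h2, h, V.parityOp_odd hv, map_neg]
  intro j
  fin_cases j
  exacts [h0, h1]

/-- A subspace is graded when it contains the even components of its elements. -/
theorem eq_sup_of_components {W : Submodule k V.carrier}
    (h : ∀ x ∈ V.part 0, ∀ y ∈ V.part 1, x + y ∈ W → x ∈ W) :
    W = (W ⊓ V.part 0) ⊔ (W ⊓ V.part 1) := by
  refine le_antisymm (fun v hv => ?_) (sup_le inf_le_left inf_le_left)
  obtain ⟨x, hx, y, hy, rfl⟩ := V.exists_add v
  have hxW := h x hx y hy hv
  have hyW : y ∈ W := by simpa using sub_mem hv hxW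
  exact add_mem (Submodule.mem_sup_left ⟨hxW, hx⟩) (Submodule.mem_sup_right ⟨hyW, hy⟩)

variable {V} in
/-- Schur's lemma: an injectivity statement for homogeneous operators. -/
theorem IsSimple.ker_eq (hV : V.IsSimple) {p : ZMod 2} {f : Module.End k V.carrier}
    (hf : ∀ j, ∀ v ∈ V.part j, f v ∈ V.part (p + j))
    (hker : ∀ a v, f v = 0 → f (V.ρ a v) = 0) :
    LinearMap.ker f = ⊥ ∨ f = 0 := by
  rw [← LinearMap.ker_eq_top]
  refine hV.2 _ (fun a w hw => hker a w hw) (V.eq_sup_of_components fun x hx y hy hxy => ?_)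
  have h0 := hf 0 x hx
  have h1 := hf 1 y hy
  rw [LinearMap.mem_ker, map_add] at hxy
  have hd : Disjoint (V.part (p + 0)) (V.part (p + 1)) := by
    fin_cases p
    · exact V.isCompl.disjoint
    · exact V.isCompl.disjoint.symm
  refine Submodule.disjoint_def.mp hd _ h0 ?_
  rw [eq_neg_of_add_eq_zero_left hxy]
  exact neg_mem h1

variable {V} in
/-- Schur's lemma over an algebraically closed field. -/
theorem IsSimple.exists_eq_smul_of_isAlgClosed [IsAlgClosed k] (hV : V.IsSimple)
    {f : Module.End k V.carrier} (hf : V.IsEven f) (hcomm : ∀ a v, f (V.ρ a v) = V.ρ a (f v)) :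
    ∃ c : k, f = c • 1 := by
  have := hV.1
  obtain ⟨μ, hμ⟩ := Module.End.exists_eigenvalue f
  refine ⟨μ, sub_eq_zero.mp ((hV.ker_eq (p := 0) (fun j v hv => ?_)
    (fun a v hv => ?_)).resolve_left ?_)⟩
  · rw [zero_add]
    exact sub_mem (hf j v hv) (Submodule.smul_mem _ _ hv)
  · rw [LinearMap.sub_apply, LinearMap.smul_apply, Module.End.one_apply] at hv ⊢
    rw [hcomm, ← map_smul, ← map_sub, hv, map_zero]
  · rw [← Module.End.eigenspace_def]
    exact hμ

variable {V} in
/-- Schur's lemma over a splitting field. -/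
theorem IsSimple.exists_eq_smul (hV : V.IsSimple)
    (hsplit : (V.extend (AlgebraicClosure k)).IsSimple) {f : Module.End k V.carrier}
    (hf : V.IsEven f) (hcomm : ∀ a, Commute (V.ρ a) f) : ∃ c : k, f = c • 1 := by
  have := hV.1
  have hcomm' (a) (v) : f (V.ρ a v) = V.ρ a (f v) :=
    (congrArg (fun g : Module.End k V.carrier => g v) (hcomm a).eq).symm
  let K := AlgebraicClosure k
  have hcommK (a : K ⊗[k] A) (v : K ⊗[k] V.carrier) :
      f.baseChange K (V.extendAction K a v) = V.extendAction K a (f.baseChange K v) := by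
    induction a using TensorProduct.induction_on with
    | zero => simp
    | add x y hx hy => rw [map_add, LinearMap.add_apply, LinearMap.add_apply, map_add, hx, hy]
    | tmul c a =>
      induction v using TensorProduct.induction_on with
      | zero => simp
      | add x y hx hy => rw [map_add, map_add, map_add, map_add, hx, hy]
      | tmul d v =>
        rw [extendAction_tmul, LinearMap.baseChange_tmul, LinearMap.baseChange_tmul,
          extendAction_tmul, hcomm']
  have hevenK (j : ZMod 2) (v : K ⊗[k] V.carrier) (hv : v ∈ (V.part j).baseChange K) :
      f.baseChange K v ∈ (V.part j).baseChange K := by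
    rw [Submodule.baseChange_eq_span] at hv
    induction hv using Submodule.span_induction with
    | zero => rw [map_zero]; exact zero_mem _
    | add x y _ _ hx hy => rw [map_add]; exact add_mem hx hy
    | smul c x _ hx => rw [map_smul]; exact Submodule.smul_mem _ c hx
    | mem x hx =>
      obtain ⟨v, hv, rfl⟩ := hx
      rw [TensorProduct.mk_apply, LinearMap.baseChange_tmul]
      exact Submodule.tmul_mem_baseChange_of_mem _ (hf j v hv)
  obtain ⟨μ, hμ⟩ := hsplit.exists_eq_smul_of_isAlgClosed (f := f.baseChange K) hevenK hcommK
  have hg (v : V.carrier) : (1 : K) ⊗ₜ[k] f v = μ ⊗ₜ[k] v := by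
    have h := congrArg (fun g : Module.End K (K ⊗[k] V.carrier) => g ((1 : K) ⊗ₜ[k] v)) hμ
    change f.baseChange K ((1 : K) ⊗ₜ[k] v) = μ • ((1 : K) ⊗ₜ[k] v) at h
    rwa [LinearMap.baseChange_tmul, TensorProduct.smul_tmul', smul_eq_mul, mul_one] at h
  obtain ⟨v₀, hv₀⟩ := exists_ne (0 : V.carrier)
  -- A functional that does not vanish at `v₀` reads off the scalar `μ`, found over the algebraic
  -- closure, as a quotient of elements of `k`.
  obtain ⟨ℓ, hℓ⟩ := Module.Projective.exists_dual_ne_zero k hv₀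
  have hμ' : μ = algebraMap k K (ℓ (f v₀) / ℓ v₀) := by
    have h := congrArg (TensorProduct.rid k K ∘ ℓ.lTensor K) (hg v₀)
    simp only [Function.comp_apply, LinearMap.lTensor_tmul, TensorProduct.rid_tmul] at h
    rw [Algebra.smul_def, Algebra.smul_def, mul_one] at h
    rw [map_div₀, h, mul_div_cancel_left₀ _ (by simpa using hℓ)]
  refine ⟨ℓ (f v₀) / ℓ v₀, LinearMap.ext fun v => ?_⟩
  have hinj : Function.Injective fun v : V.carrier => (1 : K) ⊗ₜ[k] v :=
    (Module.Flat.rTensor_preserves_injective_linearMap (M := V.carrier)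
      (Algebra.linearMap k K) (algebraMap k K).injective).comp
      (TensorProduct.lid k V.carrier).symm.injective |> fun h => by
        convert h using 1
        ext v
        simp
  refine hinj ?_
  simp only [LinearMap.smul_apply, Module.End.one_apply]
  rw [hg, hμ', TensorProduct.tmul_smul, TensorProduct.smul_tmul', Algebra.smul_def, mul_one]

end SuperModule

/-! ### Base change, and scalar averages as multiples of a trace form. -/

section BaseChange

variable {R : Type*} [CommRing R] {A : Type*} [Ring A] [Algebra R A] {t : A →ₗ[R] R}
  (S : Type*) [CommRing S] [Algebra R S]

@[simp] theorem baseChangeForm_tmul (t : A →ₗ[R] R) (c : S) (a : A) :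
    baseChangeForm S t (c ⊗ₜ[R] a) = t a • c := by
  simp [baseChangeForm]

theorem IsDualBasis.baseChange {n : ℕ} {b : Module.Basis (Fin n) R A} {b' : Fin n → A}
    (hd : IsDualBasis t b b') :
    IsDualBasis (baseChangeForm S t) (b.baseChange S) (fun i => 1 ⊗ₜ[R] b' i) := fun i j => by
  simp only [Module.Basis.baseChange_apply, Algebra.TensorProduct.tmul_mul_tmul, mul_one,
    baseChangeForm_tmul, hd i j]
  split_ifs <;> simp

theorem IsHomogeneousBasis.baseChange {𝒜 : ZMod 2 → Submodule R A} {n : ℕ}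
    {b : Module.Basis (Fin n) R A} {p : Fin n → ZMod 2} (h : IsHomogeneousBasis 𝒜 b p) :
    IsHomogeneousBasis (SuperAlg.baseChange S 𝒜) (b.baseChange S) p := fun i => by
  rw [Module.Basis.baseChange_apply]
  exact Submodule.tmul_mem_baseChange_of_mem 1 (h i)

/-- The base change of an algebra endomorphism. -/
noncomputable abbrev baseChangeHom (σ : A →ₐ[R] A) : S ⊗[R] A →ₐ[S] S ⊗[R] A :=
  Algebra.TensorProduct.map (AlgHom.id S S) σ

theorem IsTwistedSymmetric.baseChange {σ : A →ₐ[R] A} (h : IsTwistedSymmetric t σ) :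
    IsTwistedSymmetric (baseChangeForm S t) (baseChangeHom S σ) := by
  refine ⟨fun x => ?_, fun x y => ?_⟩
  · induction x using TensorProduct.induction_on with
    | zero => simp only [map_zero]
    | add x y hx hy => rw [map_add, map_add, hx, hy]
    | tmul c a => simp [h.involutive]
  · induction x using TensorProduct.induction_on with
    | zero => simp only [map_zero, zero_mul, mul_zero]
    | add x x' hx hy => rw [map_add, add_mul, mul_add, map_add, map_add, hx, hy]
    | tmul c a =>
      induction y using TensorProduct.induction_on with
      | zero => simp only [map_zero, zero_mul, mul_zero]
      | add x y hx hy => rw [add_mul, mul_add, map_add, map_add, hx, hy]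
      | tmul d a' => simp [h.symm a a', mul_comm c d]

end BaseChange

section Average

variable {R : Type*} [CommRing R] {A : Type*} [Ring A] [Algebra R A] {t : A →ₗ[R] R}
  {σ : A →ₐ[R] A} {E : Type*} [Ring E] [Algebra R E] (ρ : A →ₐ[R] E)
  {n : ℕ} {b : Module.Basis (Fin n) R A} {b' : Fin n → A}

/-- If averages of all elements of a class `p` are scalars, then they are given by a multiple of
the trace form. -/
theorem exists_average_eq (ht : IsTwistedSymmetric t σ) (hd : IsDualBasis t b b')
    (τ : E →ₗ[R] R) (hτ : ∀ x y, τ (x * y) = τ (y * x)) (w : E)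
    (hw : ∀ a, w * ρ a = ρ (σ a) * w) (p : E → Prop)
    (hp : ∀ f, p f → ∃ c : R, average σ ρ b b' f = c • 1) {e : E} (he : p e)
    (hu : IsUnit (τ (w * e))) :
    ∃ s : R, ∀ f, p f → average σ ρ b b' f = (s * τ (w * f)) • 1 := by
  obtain ⟨u, hu⟩ := hu
  obtain ⟨c, hc⟩ := hp e he
  refine ⟨c * ↑u⁻¹, fun f hf => ?_⟩
  obtain ⟨d, hd'⟩ := hp f hf
  -- With scalar averages `c` of `e` and `d` of `f`, self-adjointness reads `d τ(w e) = c τ(w f)`;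
  -- division by the unit `τ(w e)` gives `d`.
  have key := trace_average ρ ht hd τ hτ w hw e f
  rw [hd', hc] at key
  simp only [mul_smul_comm, mul_one, map_smul, smul_eq_mul, ← hu, smul_mul_assoc] at key
  rw [hd', mul_right_comm, ← key, mul_assoc, Units.mul_inv, mul_one]

end Average

section RankOne

variable {O : Type*} [CommRing O] [IsLocalRing O] {n : ℕ}

/-- Supplies the test operators of the whole proof. The image is required to lie in `K` because the
irreducibility argument averages such an operator inside a given sublattice. -/
theorem exists_even_rank_one (h2 : IsUnit (2 : O)) {P : Matrix (Fin n) (Fin n) O} (hP : P * P = 1)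
    (K : Submodule O (Fin n → O)) (hK : ∀ x ∈ K, P.mulVec x ∈ K) {x : Fin n → O} (hx : x ∈ K)
    {i : Fin n} (hi : IsUnit (x i)) :
    ∃ e : Matrix (Fin n) (Fin n) O, Commute P e ∧ (∀ c, e.mulVec c ∈ K) ∧ IsUnit e.trace ∧
      IsUnit (P * e).trace := by
  have hPP (y : Fin n → O) : P.mulVec (P.mulVec y) = y := by simp [hP]
  -- The vectors `x + P x` and `x - P x` are homogeneous, and their `i`-th coordinates add up to the
  -- unit `2 x_i`; in a local ring one of these coordinates is a unit.
  obtain ⟨y, ε, hy, hε, hPy, hyi⟩ : ∃ (y : Fin n → O) (ε : O), y ∈ K ∧ ε * ε = 1 ∧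
      P.mulVec y = ε • y ∧ IsUnit (y i) := by
    have hsum : IsUnit ((x + P.mulVec x) i + (x - P.mulVec x) i) := by
      have : (x + P.mulVec x) i + (x - P.mulVec x) i = 2 * x i := by
        simp only [Pi.add_apply, Pi.sub_apply]; ring
      rw [this]
      exact h2.mul hi
    obtain h | h := IsLocalRing.isUnit_or_isUnit_of_isUnit_add hsum
    · exact ⟨_, 1, add_mem hx (hK x hx), by ring, by
        rw [Matrix.mulVec_add, hPP, one_smul, add_comm], h⟩
    · exact ⟨_, -1, sub_mem hx (hK x hx), by ring, by
        rw [Matrix.mulVec_sub, hPP, neg_one_smul, neg_sub], h⟩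
  let ℓ₀ : Fin n → O := Pi.single i 1
  -- The coordinate functional projected, up to a factor `2`, to the `ε`-eigenspace of `P`, so that
  -- `y ℓ` is even and `P` acts on it by `ε`.
  let ℓ : Fin n → O := ℓ₀ + ε • Matrix.vecMul ℓ₀ P
  have hℓP : Matrix.vecMul ℓ P = ε • ℓ := by
    simp only [ℓ, Matrix.add_vecMul, Matrix.smul_vecMul, Matrix.vecMul_vecMul, hP,
      Matrix.vecMul_one, smul_add, smul_smul, hε, one_smul]
    exact add_comm _ _
  have hℓy : ℓ ⬝ᵥ y = 2 * y i := by
    simp only [ℓ, add_dotProduct, smul_dotProduct, ← Matrix.dotProduct_mulVec, hPy,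
      dotProduct_smul, smul_smul, hε, one_smul]
    simp [ℓ₀, two_mul]
  have hPe : P * Matrix.vecMulVec y ℓ = ε • Matrix.vecMulVec y ℓ := by
    rw [Matrix.mul_vecMulVec, hPy, Matrix.smul_vecMulVec]
  have htr : (Matrix.vecMulVec y ℓ).trace = 2 * y i := by
    rw [Matrix.trace_vecMulVec, dotProduct_comm, hℓy]
  refine ⟨Matrix.vecMulVec y ℓ, ?_, fun c => ?_, ?_, ?_⟩
  · rw [commute_iff_eq, hPe, Matrix.vecMulVec_mul, hℓP, Matrix.vecMulVec_smul]
  · rw [Matrix.vecMulVec_mulVec]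
    simpa using K.smul_mem _ hy
  · rw [htr]
    exact h2.mul hyi
  · rw [hPe, Matrix.trace_smul, htr]
    exact (IsUnit.of_mul_eq_one _ hε).mul (h2.mul hyi)

end RankOne

/-! ### Odd automorphisms of simple modules not of type `M`. -/

namespace SuperModule

variable {k : Type u} [Field k] {A : Type w} [Ring A] [Algebra k A]
  {𝒜 : ZMod 2 → Submodule k A} {V : SuperModule 𝒜}

/-- A simple module over a split superalgebra that is not of type `M` has an odd automorphism. -/
theorem IsSimple.exists_odd (hV : V.IsSimple) (hsplit : (V.extend (AlgebraicClosure k)).IsSimple)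
    {γ : A ≃ₐ[k] A} (hγ : IsParity 𝒜 γ) (hM : ¬ V.IsTypeM) :
    ∃ T T' : Module.End k V.carrier, T * T' = 1 ∧ T' * T = 1 ∧
      V.parityOp * T = -(T * V.parityOp) ∧ V.parityOp * T' = -(T' * V.parityOp) ∧
      (∀ a, T * V.ρ a = V.ρ (γ a) * T) ∧ ∀ a, T' * V.ρ (γ a) = V.ρ a * T' := by
  have := hV.1
  have h0 : V.superEndPart 0 = Submodule.span k {1} := by
    refine le_antisymm (fun f hf => ?_) ?_
    · obtain ⟨c, hc⟩ := hV.exists_eq_smul hsplit (f := f)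
        (fun j v hv => by simpa using hf.1 j v hv) (fun a => by
          obtain ⟨y, hy, z, hz, rfl⟩ := hγ.exists_add a
          refine LinearMap.ext fun v => ?_
          have h1 := hf.2 0 y hy v
          have h2 := hf.2 1 z hz v
          simp only [zero_mul, ZMod.val_zero, pow_zero, one_smul] at h1 h2
          simp [h1, h2])
      rw [hc]
      exact Submodule.smul_mem _ _ (Submodule.mem_span_singleton_self 1)
    · rw [Submodule.span_singleton_le_iff_mem]
      exact ⟨by simp, by simp⟩
  have h1 : V.superEndPart 1 ≠ ⊥ := fun h1 => hM <| by
    rw [IsTypeM, superEnd, h0, h1, sup_bot_eq]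
    exact finrank_span_singleton one_ne_zero
  obtain ⟨T, hT, hT0⟩ := Submodule.exists_mem_ne_zero_of_ne_bot h1
  have hTγ (a : A) : T * V.ρ a = V.ρ (γ a) * T := by
    obtain ⟨y, hy, z, hz, rfl⟩ := hγ.exists_add a
    refine LinearMap.ext fun v => ?_
    have h1 := hT.2 0 y hy v
    have h2 := hT.2 1 z hz v
    simp only [mul_zero, one_mul, ZMod.val_zero, pow_zero, one_smul, ZMod.val_one, pow_one,
      neg_smul] at h1 h2
    simp [h1, h2, hγ.even y hy, hγ.odd z hz]
  have hTP : V.parityOp * T = -(T * V.parityOp) := by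
    refine LinearMap.ext fun v => ?_
    obtain ⟨x, hx, y, hy, rfl⟩ := V.exists_add v
    have h1 := V.parityOp_odd (hT.1 0 x hx)
    have h2 := V.parityOp_even (hT.1 1 y hy)
    simp [V.parityOp_even hx, V.parityOp_odd hy, h1, h2, add_comm]
  -- The square of an odd endomorphism is even, and the two twists by `γ` cancel, so Schur's lemma
  -- makes it a scalar; injectivity of `T` shows the scalar is nonzero.
  obtain ⟨c, hc⟩ := hV.exists_eq_smul hsplit (f := T * T)
    (fun j v hv => by
      have := hT.1 _ _ (hT.1 j v hv)
      rwa [← add_assoc, show (1 : ZMod 2) + 1 = 0 by decide, zero_add] at this)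
    (fun a => by
      refine Eq.symm ?_
      rw [mul_assoc, hTγ, ← mul_assoc, hTγ, hγ.involutive, mul_assoc])
  have hker := (hV.ker_eq hT.1 (fun a v hv => by
    have := congrArg (fun g : Module.End k V.carrier => g v) (hTγ a)
    simpa [hv] using this)).resolve_right hT0
  have hc0 : c ≠ 0 := by
    rintro rfl
    obtain ⟨v, hv⟩ := exists_ne (0 : V.carrier)
    have hinj := LinearMap.ker_eq_bot.mp hker
    have h := congrArg (fun g : Module.End k V.carrier => g v) hc
    simp only [zero_smul, LinearMap.zero_apply, Module.End.mul_apply] at h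
    exact hv (hinj (hinj (by simpa using h)))
  refine ⟨T, c⁻¹ • T, ?_, ?_, hTP, ?_, hTγ, fun a => ?_⟩
  · rw [mul_smul_comm, hc, smul_smul, inv_mul_cancel₀ hc0, one_smul]
  · rw [smul_mul_assoc, hc, smul_smul, inv_mul_cancel₀ hc0, one_smul]
  · rw [mul_smul_comm, hTP, smul_mul_assoc, smul_neg]
  · rw [smul_mul_assoc, hTγ, hγ.involutive, mul_smul_comm]

end SuperModule

/-! ### Integral forms and integrality of the Schur elements. -/

section IntegralForm

variable {O : Type u} [CommRing O] {F : Type v} [Field F] [Algebra O F]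
  {A : Type w} [Ring A] [Algebra O A] {𝒜 : ZMod 2 → Submodule O A}

/-- An `O`-form of a supermodule: a basis in which `A` and the parity operator act by matrices
with entries in `O`. -/
structure IntegralForm (V : SuperModule (baseChange F 𝒜)) where
  /-- the rank -/
  rank : ℕ
  /-- the basis -/
  basis : Module.Basis (Fin rank) F V.carrier
  /-- the matrix representation of `A` -/
  ρ : A →ₐ[O] Matrix (Fin rank) (Fin rank) O
  /-- the matrix of the parity operator -/
  P : Matrix (Fin rank) (Fin rank) O
  toMatrix_ρ : ∀ a, LinearMap.toMatrixAlgEquiv basis (V.ρ (1 ⊗ₜ[O] a)) =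
    (ρ a).map (algebraMap O F)
  toMatrix_parityOp : LinearMap.toMatrixAlgEquiv basis V.parityOp = P.map (algebraMap O F)

namespace IntegralForm

variable {V : SuperModule (baseChange F 𝒜)} (I : IntegralForm V)

/-- The endomorphism of `V` with a given matrix. -/
noncomputable def toEnd : Matrix (Fin I.rank) (Fin I.rank) O →+* Module.End F V.carrier :=
  ((LinearMap.toMatrixAlgEquiv I.basis).symm : _ →+* _).comp (algebraMap O F).mapMatrix

theorem toMatrix_toEnd (f : Matrix (Fin I.rank) (Fin I.rank) O) :
    LinearMap.toMatrixAlgEquiv I.basis (I.toEnd f) = f.map (algebraMap O F) := by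
  simp [toEnd]

theorem toEnd_ρ (a : A) : I.toEnd (I.ρ a) = V.ρ (1 ⊗ₜ[O] a) := by
  apply (LinearMap.toMatrixAlgEquiv I.basis).injective
  rw [toMatrix_toEnd, I.toMatrix_ρ]

theorem toEnd_P : I.toEnd I.P = V.parityOp := by
  apply (LinearMap.toMatrixAlgEquiv I.basis).injective
  rw [toMatrix_toEnd, I.toMatrix_parityOp]

theorem toEnd_smul (c : O) (f : Matrix (Fin I.rank) (Fin I.rank) O) :
    I.toEnd (c • f) = algebraMap O F c • I.toEnd f := by
  apply (LinearMap.toMatrixAlgEquiv I.basis).injective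
  rw [_root_.map_smul (LinearMap.toMatrixAlgEquiv I.basis) (algebraMap O F c), toMatrix_toEnd,
    toMatrix_toEnd]
  ext i j
  simp

theorem trace_toEnd (f : Matrix (Fin I.rank) (Fin I.rank) O) :
    LinearMap.trace F V.carrier (I.toEnd f) = algebraMap O F f.trace := by
  rw [LinearMap.trace_eq_matrix_trace F I.basis]
  change (LinearMap.toMatrixAlgEquiv I.basis (I.toEnd f)).trace = _
  rw [toMatrix_toEnd]
  simp [Matrix.trace]

theorem toEnd_average {σ : A →ₐ[O] A} {n : ℕ} (b : Module.Basis (Fin n) O A) (b' : Fin n → A)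
    (f : Matrix (Fin I.rank) (Fin I.rank) O) :
    I.toEnd (average σ I.ρ b b' f) = average (baseChangeHom F σ) V.ρ (b.baseChange F)
      (fun i => 1 ⊗ₜ[O] b' i) (I.toEnd f) := by
  simp [average, toEnd_ρ]

theorem exists_index (hV : V.IsSimple) : ∃ _ : Fin I.rank, True := by
  have := hV.1
  exact ⟨I.basis.index_nonempty.some, trivial⟩

variable [IsFractionRing O F]

theorem toEnd_injective : Function.Injective I.toEnd :=
  (LinearMap.toMatrixAlgEquiv I.basis).symm.injective.comp
    (Matrix.map_injective (IsFractionRing.injective O F))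

theorem P_mul_self : I.P * I.P = 1 := I.toEnd_injective <| by
  rw [map_mul, toEnd_P, V.parityOp_mul_self, map_one]

theorem P_mul_ρ {γ : A ≃ₐ[O] A} (hγ : IsParity 𝒜 γ) (a : A) :
    I.P * I.ρ a = I.ρ (γ a) * I.P := I.toEnd_injective <| by
  rw [map_mul, map_mul, toEnd_P, toEnd_ρ, toEnd_ρ, V.parityOp_mul_rho (hγ.baseChange F)]
  simp

theorem exists_toEnd_eq_smul [IsDomain O] (f : Module.End F V.carrier) :
    ∃ (d : O) (g : Matrix (Fin I.rank) (Fin I.rank) O), d ≠ 0 ∧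
      I.toEnd g = algebraMap O F d • f := by
  obtain ⟨d, hd⟩ := IsLocalization.exist_integer_multiples_of_finite (nonZeroDivisors O)
    (fun x : Fin I.rank × Fin I.rank => LinearMap.toMatrixAlgEquiv I.basis f x.1 x.2)
  choose g hg using hd
  refine ⟨d, Matrix.of fun i j => g (i, j), nonZeroDivisors.coe_ne_zero d, ?_⟩
  apply (LinearMap.toMatrixAlgEquiv I.basis).injective
  rw [toMatrix_toEnd, map_smul]
  ext i j
  simpa [Algebra.smul_def] using hg (i, j)

end IntegralForm

end IntegralForm

namespace IntegralForm

variable {O : Type u} [CommRing O] {F : Type v} [Field F] [Algebra O F]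
  [IsFractionRing O F] {A : Type w} [Ring A] [Algebra O A] {𝒜 : ZMod 2 → Submodule O A}
  {V : SuperModule (baseChange F 𝒜)} (I : IntegralForm V)
  {γ : A ≃ₐ[O] A} {σ : A →ₐ[O] A} {t : A →ₗ[O] O}
  {n : ℕ} {b : Module.Basis (Fin n) O A} {b' : Fin n → A}

theorem average_mul_P (hγ : IsParity 𝒜 γ) (ht : IsTwistedSymmetric t σ)
    (hte : ∀ a ∈ 𝒜 1, t a = 0) (hσγ : ∀ x, σ (γ x) = γ (σ x)) (hd : IsDualBasis t b b')
    (f : Matrix (Fin I.rank) (Fin I.rank) O) :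
    average σ I.ρ b b' (I.P * f * I.P) = I.P * average σ I.ρ b b' f * I.P :=
  average_conj I.ρ ht hd γ (hγ.form_eq hte) hσγ (I.P_mul_ρ hγ)
    (fun a => by rw [I.P_mul_ρ hγ, hγ.involutive]) f

theorem commute_P_average (hγ : IsParity 𝒜 γ) (ht : IsTwistedSymmetric t σ)
    (hte : ∀ a ∈ 𝒜 1, t a = 0) (hσγ : ∀ x, σ (γ x) = γ (σ x)) (hd : IsDualBasis t b b')
    {f : Matrix (Fin I.rank) (Fin I.rank) O} (hf : Commute I.P f) :
    Commute I.P (average σ I.ρ b b' f) := by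
  have h := I.average_mul_P hγ ht hte hσγ hd f
  rw [hf.eq, mul_assoc, I.P_mul_self, mul_one] at h
  rw [commute_iff_eq]
  conv_rhs => rw [h]
  rw [mul_assoc, I.P_mul_self, mul_one]

/-- The average is even and commutes with `A`, so Schur's lemma over `F` applies to it. Being a
matrix over `O`, it has its scalar in `O`. -/
theorem exists_average_eq_smul (hV : V.IsSimple)
    (hsplit : (V.extend (AlgebraicClosure F)).IsSimple) (h2 : IsUnit (2 : O))
    (hγ : IsParity 𝒜 γ) (ht : IsTwistedSymmetric t σ)
    (hte : ∀ a ∈ 𝒜 1, t a = 0) (hσγ : ∀ x, σ (γ x) = γ (σ x)) (hd : IsDualBasis t b b')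
    {f : Matrix (Fin I.rank) (Fin I.rank) O} (hf : Commute I.P f) :
    ∃ c : O, average σ I.ρ b b' f = c • 1 := by
  obtain ⟨i, -⟩ := I.exists_index hV
  set g := average σ I.ρ b b' f with hg
  have h2F : (2 : F) ≠ 0 := by
    have := (h2.map (algebraMap O F)).ne_zero
    rwa [map_ofNat] at this
  obtain ⟨c, hc⟩ := hV.exists_eq_smul hsplit (f := I.toEnd g)
    (SuperModule.isEven_of_commute h2F (by
      rw [← I.toEnd_P]
      exact (I.commute_P_average hγ ht hte hσγ hd hf).map I.toEnd))
    (fun a => by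
      rw [commute_iff_eq]
      induction a using TensorProduct.induction_on with
      | zero => simp
      | add x y hx hy => rw [map_add, add_mul, mul_add, hx, hy]
      | tmul d a =>
        rw [show d ⊗ₜ[O] a = d • ((1 : F) ⊗ₜ[O] a) by simp [TensorProduct.smul_tmul'],
          map_smul, ← I.toEnd_ρ, smul_mul_assoc, mul_smul_comm, ← map_mul, ← map_mul,
          (commute_average I.ρ ht hd f a).eq])
  have hc' : g.map (algebraMap O F) = c • 1 := by
    rw [← I.toMatrix_toEnd, hc, map_smul, map_one]
  refine ⟨g i i, Matrix.map_injective (IsFractionRing.injective O F) ?_⟩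
  have hi : algebraMap O F (g i i) = c := by
    simpa using congrFun (congrFun hc' i) i
  change g.map _ = _
  rw [hc']
  ext j l
  by_cases h : j = l <;> simp [h, hi]

variable {u : Matrix (Fin I.rank) (Fin I.rank) O}

theorem exists_even_isUnit_trace [IsLocalRing O] (h2 : IsUnit (2 : O)) (hV : V.IsSimple)
    (hu : u = 1 ∨ u = I.P) :
    ∃ e, Commute I.P e ∧ IsUnit (u * e).trace := by
  obtain ⟨i, -⟩ := I.exists_index hV
  obtain ⟨e, he, -, h1, hP⟩ := exists_even_rank_one h2 I.P_mul_self ⊤ (fun _ _ => trivial)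
    (x := Pi.single i 1) (i := i) trivial (by simp)
  refine ⟨e, he, ?_⟩
  obtain rfl | rfl := hu
  · rwa [one_mul]
  · exact hP

/-- The Schur element of an integral form. -/
theorem exists_schur [IsLocalRing O] (hV : V.IsSimple)
    (hsplit : (V.extend (AlgebraicClosure F)).IsSimple) (h2 : IsUnit (2 : O))
    (hγ : IsParity 𝒜 γ) (ht : IsTwistedSymmetric t σ)
    (hte : ∀ a ∈ 𝒜 1, t a = 0) (hσγ : ∀ x, σ (γ x) = γ (σ x)) (hd : IsDualBasis t b b')
    (hu : u = 1 ∨ u = I.P) (huρ : ∀ a, u * I.ρ a = I.ρ (σ a) * u) :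
    ∃ s : O, ∀ f, Commute I.P f → average σ I.ρ b b' f = (s * (u * f).trace) • 1 := by
  obtain ⟨e, he, hue⟩ := I.exists_even_isUnit_trace h2 hV hu
  exact exists_average_eq I.ρ ht hd (Matrix.traceLinearMap (Fin I.rank) O O)
    Matrix.trace_mul_comm u huρ (fun f => Commute I.P f)
    (fun f hf => I.exists_average_eq_smul hV hsplit h2 hγ ht hte hσγ hd hf) he hue

variable [IsDomain O] {s : O}

/-- Passes from even `O`-matrices and one dual pair to all even operators over `F` and all dual
pairs: clear denominators, then use basis independence. -/
theorem average_eq (ht : IsTwistedSymmetric t σ) (hd : IsDualBasis t b b')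
    (hs : ∀ f, Commute I.P f → average σ I.ρ b b' f = (s * (u * f).trace) • 1)
    {m : ℕ} {c : Module.Basis (Fin m) F (F ⊗[O] A)} {c' : Fin m → F ⊗[O] A}
    (hc : IsDualBasis (baseChangeForm F t) c c') {f : Module.End F V.carrier}
    (hf : Commute V.parityOp f) :
    average (baseChangeHom F σ) V.ρ c c' f =
      (algebraMap O F s * LinearMap.trace F V.carrier (I.toEnd u * f)) • 1 := by
  obtain ⟨d, g, hd0, hg⟩ := I.exists_toEnd_eq_smul f
  have hd0' : algebraMap O F d ≠ 0 := by simpa using hd0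
  have hPg : Commute I.P g := I.toEnd_injective <| by
    rw [map_mul, map_mul, I.toEnd_P, hg, mul_smul_comm, smul_mul_assoc, hf.eq]
  have h := congrArg I.toEnd (hs g hPg)
  rw [I.toEnd_average, I.toEnd_smul, map_one, hg, average_smul, map_mul, ← I.trace_toEnd, map_mul,
    hg, mul_smul_comm, map_smul, smul_eq_mul, mul_left_comm, mul_smul] at h
  rw [average_eq_of_isDualBasis V.ρ (ht.baseChange F) hc (hd.baseChange F)]
  exact smul_right_injective _ hd0' h

/-- In type `Q` the Schur element of a supersymmetrizing form vanishes. -/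
theorem schur_eq_zero [IsLocalRing O] (hV : V.IsSimple)
    (hsplit : (V.extend (AlgebraicClosure F)).IsSimple) (h2 : IsUnit (2 : O))
    (hγ : IsParity 𝒜 γ) (ht : IsTwistedSymmetric t (γ : A →ₐ[O] A))
    (hte : ∀ a ∈ 𝒜 1, t a = 0) (hd : IsDualBasis t b b')
    (hs : ∀ f, Commute I.P f → average (γ : A →ₐ[O] A) I.ρ b b' f = (s * (I.P * f).trace) • 1)
    (hM : ¬ V.IsTypeM) : s = 0 := by
  obtain ⟨T, T', hTT', hT'T, hPT, hPT', hTρ, hT'ρ⟩ :=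
    hV.exists_odd hsplit (hγ.baseChange F) hM
  obtain ⟨e, he, hue⟩ := I.exists_even_isUnit_trace h2 hV (Or.inr rfl)
  have hPe : Commute V.parityOp (I.toEnd e) := by
    rw [← I.toEnd_P]
    exact he.map I.toEnd
  have hPTe : Commute V.parityOp (T * I.toEnd e * T') := by
    rw [commute_iff_eq, ← mul_assoc, ← mul_assoc, hPT, neg_mul, neg_mul, mul_assoc T, hPe.eq,
      ← mul_assoc, mul_assoc _ V.parityOp, hPT', mul_neg, neg_neg, ← mul_assoc]
  -- Both averages are scalars, so conjugating by `T` leaves the right side unchanged; on the left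
  -- the supertrace of `T e T'` is minus that of `e`. Thus `2 s` times a unit vanishes.
  have hconj := average_conj V.ρ (ht.baseChange F) (hd.baseChange F)
    (Algebra.TensorProduct.congr AlgEquiv.refl γ)
    ((hγ.baseChange F).form_eq (t := baseChangeForm F t) (fun a ha => ?_)) (fun x => rfl)
    hTρ hT'ρ (I.toEnd e)
  · rw [I.average_eq ht hd hs (hd.baseChange F) hPTe, I.average_eq ht hd hs (hd.baseChange F) hPe,
      mul_smul_comm, mul_one, smul_mul_assoc, hTT', I.toEnd_P, ← mul_assoc, ← mul_assoc, hPT,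
      neg_mul, LinearMap.trace_mul_comm, mul_neg, map_neg, mul_assoc T, ← mul_assoc T',
      hT'T, one_mul] at hconj
    have := hV.1
    have h := smul_left_injective F (one_ne_zero (α := Module.End F V.carrier)) hconj
    simp only [mul_neg] at h
    rw [neg_eq_iff_add_eq_zero, ← two_mul, ← I.toEnd_P, ← map_mul, I.trace_toEnd, ← map_mul,
      ← map_ofNat (algebraMap O F), ← map_mul,
      map_eq_zero_iff _ (IsFractionRing.injective O F)] at h
    rwa [h2.mul_right_eq_zero, hue.mul_left_eq_zero] at h
  · rw [SuperAlg.baseChange, Submodule.baseChange_eq_span] at ha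
    induction ha using Submodule.span_induction with
    | zero => simp
    | add x y _ _ hx hy => rw [map_add, hx, hy, add_zero]
    | smul c x _ hx => rw [map_smul, hx, smul_zero]
    | mem x hx =>
      obtain ⟨a, ha, rfl⟩ := hx
      simp [hte a ha]

/-- Uniqueness comes from evaluating at the even rank-one operator, whose trace is nonzero in `F`;
existence is `average_eq`. -/
theorem isSchurElement_iff [IsLocalRing O] (h2 : IsUnit (2 : O)) (hV : V.IsSimple)
    (ht : IsTwistedSymmetric t (AlgHom.id O A))
    (hd : IsDualBasis t b b') {p : Fin n → ZMod 2} (hb : IsHomogeneousBasis 𝒜 b p)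
    (hs : ∀ f, Commute I.P f → average (AlgHom.id O A) I.ρ b b' f = (s * (1 * f).trace) • 1)
    (s' : F) : V.IsSchurElement (baseChangeForm F t) s' ↔ s' = algebraMap O F s := by
  have h2F : (2 : F) ≠ 0 := by
    have := (h2.map (algebraMap O F)).ne_zero
    rwa [map_ofNat] at this
  have key {m : ℕ} (c : Fin m → F ⊗[O] A) (c' : Fin m → F ⊗[O] A) (f : Module.End F V.carrier)
      (v : V.carrier) : ∑ i, V.ρ (c' i) (f (V.ρ (c i) v)) =
        average (baseChangeHom F (AlgHom.id O A)) V.ρ c c' f v := by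
    simp [average, LinearMap.sum_apply]
  constructor
  · intro h
    obtain ⟨e, he, hue⟩ := I.exists_even_isUnit_trace h2 hV (Or.inl rfl)
    have hPe : Commute V.parityOp (I.toEnd e) := by
      rw [← I.toEnd_P]
      exact he.map I.toEnd
    have := hV.1
    obtain ⟨v, hv⟩ := exists_ne (0 : V.carrier)
    have h1 := h n (b.baseChange F) p _ (hb.baseChange F) (hd.baseChange F) (I.toEnd e)
      (SuperModule.isEven_of_commute h2F hPe) v
    rw [key, I.average_eq ht hd hs (hd.baseChange F) hPe, map_one, one_mul, LinearMap.smul_apply,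
      Module.End.one_apply] at h1
    have h3 := smul_left_injective F hv h1
    refine (mul_right_cancel₀ ?_ h3).symm
    rw [I.trace_toEnd]
    rw [one_mul] at hue
    exact (hue.map (algebraMap O F)).ne_zero
  · rintro rfl m c q c' - hc f hf v
    rw [key, I.average_eq ht hd hs hc hf.commute, map_one, one_mul, LinearMap.smul_apply,
      Module.End.one_apply]

theorem isSuperSchurElement_iff [IsLocalRing O] (h2 : IsUnit (2 : O)) (hV : V.IsSimple)
    (hγ : IsParity 𝒜 γ) (ht : IsTwistedSymmetric t (γ : A →ₐ[O] A))
    (hd : IsDualBasis t b b') {p : Fin n → ZMod 2} (hb : IsHomogeneousBasis 𝒜 b p)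
    (hs : ∀ f, Commute I.P f → average (γ : A →ₐ[O] A) I.ρ b b' f = (s * (I.P * f).trace) • 1)
    (s' : F) : V.IsSuperSchurElement (baseChangeForm F t) s' ↔ s' = algebraMap O F s := by
  have h2F : (2 : F) ≠ 0 := by
    have := (h2.map (algebraMap O F)).ne_zero
    rwa [map_ofNat] at this
  have key {m : ℕ} (c : Module.Basis (Fin m) F (F ⊗[O] A)) (q : Fin m → ZMod 2)
      (hq : IsHomogeneousBasis (baseChange F 𝒜) c q) (c' : Fin m → F ⊗[O] A)
      (f : Module.End F V.carrier) (v : V.carrier) :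
      ∑ i, ((-1 : F) ^ (q i).val) • V.ρ (c' i) (f (V.ρ (c i) v)) =
        average (baseChangeHom F (γ : A →ₐ[O] A)) V.ρ c c' f v := by
    have hq' (i) : baseChangeHom F (γ : A →ₐ[O] A) (c i) = ((-1 : F) ^ (q i).val) • c i :=
      (hγ.baseChange F).apply_of_mem (hq i)
    simp [average, LinearMap.sum_apply, hq']
  constructor
  · intro h
    obtain ⟨e, he, hue⟩ := I.exists_even_isUnit_trace h2 hV (Or.inr rfl)
    have hPe : Commute V.parityOp (I.toEnd e) := by
      rw [← I.toEnd_P]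
      exact he.map I.toEnd
    have := hV.1
    obtain ⟨v, hv⟩ := exists_ne (0 : V.carrier)
    have h1 := h n (b.baseChange F) p _ (hb.baseChange F) (hd.baseChange F) (I.toEnd e)
      (SuperModule.isEven_of_commute h2F hPe) v
    rw [key _ _ (hb.baseChange F), I.average_eq ht hd hs (hd.baseChange F) hPe, I.toEnd_P,
      ← V.superTrace_eq, LinearMap.smul_apply, Module.End.one_apply] at h1
    have h3 := smul_left_injective F hv h1
    refine (mul_right_cancel₀ ?_ h3).symm
    rw [V.superTrace_eq, ← I.toEnd_P, ← map_mul, I.trace_toEnd]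
    exact (hue.map (algebraMap O F)).ne_zero
  · rintro rfl m c q c' hq hc f hf v
    rw [key c q hq, I.average_eq ht hd hs hc hf.commute, I.toEnd_P, ← V.superTrace_eq,
      LinearMap.smul_apply, Module.End.one_apply]

end IntegralForm

/-! ### Existence of integral forms. -/

namespace SuperModule

/-- A subspace stable under the parity operator is graded. -/
theorem eq_sup_of_parityOp {k : Type u} [Field k] {A : Type w} [Ring A] [Algebra k A]
    {𝒜 : ZMod 2 → Submodule k A} (V : SuperModule 𝒜) (h2 : (2 : k) ≠ 0)
    {W : Submodule k V.carrier} (hW : ∀ w ∈ W, V.parityOp w ∈ W) :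
    W = (W ⊓ V.part 0) ⊔ (W ⊓ V.part 1) := by
  refine V.eq_sup_of_components fun x hx y hy hxy => ?_
  have h := add_mem hxy (hW _ hxy)
  rw [map_add, V.parityOp_even hx, V.parityOp_odd hy, add_add_add_comm, add_neg_cancel, add_zero,
    ← two_smul k] at h
  exact (W.smul_mem_iff h2).mp h

end SuperModule

section Lattice

variable {O : Type*} [CommRing O] {F : Type*} [Field F] [Algebra O F] [IsFractionRing O F]
  {M : Type*} [AddCommGroup M] [Module F M] [Module O M] [IsScalarTower O F M]
  {L : Submodule O M} [L.IsLattice F]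

theorem repr_extendOfIsLattice {n : ℕ} (b : Module.Basis (Fin n) O L) (y : L) (i : Fin n) :
    (b.extendOfIsLattice F).repr (y : M) i = algebraMap O F (b.repr y i) := by
  have h : (y : M) = ∑ i, algebraMap O F (b.repr y i) • b.extendOfIsLattice F i := by
    refine (congrArg L.subtype (b.sum_repr y)).symm.trans ?_
    rw [map_sum]
    simp
  rw [h, Module.Basis.repr_sum_self]

theorem toMatrix_extendOfIsLattice {n : ℕ} (b : Module.Basis (Fin n) O L) (g : Module.End F M)
    (g' : Module.End O L) (h : ∀ x : L, (g' x : M) = g x) :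
    LinearMap.toMatrixAlgEquiv (b.extendOfIsLattice F) g =
      (LinearMap.toMatrixAlgEquiv b g').map (algebraMap O F) := by
  ext i j
  rw [LinearMap.toMatrixAlgEquiv_apply, Matrix.map_apply, LinearMap.toMatrixAlgEquiv_apply,
    Module.Basis.extendOfIsLattice_apply, ← h, repr_extendOfIsLattice]

end Lattice

section

variable {O : Type u} [CommRing O] [IsDomain O] [IsPrincipalIdealRing O] {F : Type v} [Field F]
  [Algebra O F] [IsFractionRing O F] {A : Type w} [Ring A] [Algebra O A] [Module.Finite O A]
  {𝒜 : ZMod 2 → Submodule O A} {V : SuperModule (baseChange F 𝒜)} {γ : A ≃ₐ[O] A}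

/-- The spanning image of an `A`-stable submodule of `A` yields an integral form of `V`. -/
theorem exists_integralForm (N : Submodule O A) (hN : ∀ (a : A) (x : N), a * x ∈ N)
    (hNγ : ∀ x : N, γ x ∈ N) (j : N →+ V.carrier)
    (hj : ∀ (c : O) (x : N), j (c • x) = algebraMap O F c • j x)
    (hspan : Submodule.span F (Set.range j) = ⊤)
    (hjρ : ∀ (a : A) (x : N), j ⟨a * x, hN a x⟩ = V.ρ (1 ⊗ₜ[O] a) (j x))
    (ε : O) (hjP : ∀ x : N, V.parityOp (j x) = algebraMap O F ε • j ⟨γ x, hNγ x⟩) :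
    ∃ (I : IntegralForm V) (q : N →ₗ[O] (Fin I.rank → O)), Function.Surjective q ∧
      ∀ x i, I.basis.repr (j x) i = algebraMap O F (q x i) := by
  let _ : Module O V.carrier := Module.compHom _ (algebraMap O F)
  have : IsScalarTower O F V.carrier :=
    ⟨fun c f v => by
      rw [Algebra.smul_def, mul_smul]
      rfl⟩
  let j' : N →ₗ[O] V.carrier := { j with map_smul' := hj }
  -- A finitely generated spanning `O`-submodule of an `F`-space is torsion-free, hence free over
  -- the principal ideal domain `O`, and its bases are bases of `V`.
  let L := LinearMap.range j'
  have : IsNoetherian O A := isNoetherian_of_isNoetherianRing_of_finite O A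
  have : L.IsLattice F :=
    ⟨by
      rw [← Module.Finite.iff_fg]
      infer_instance, hspan⟩
  have : Module.Free O L := Submodule.IsLattice.free F L
  let b := Module.finBasis O L
  have hρ (a : A) (y : V.carrier) (hy : y ∈ L) : V.ρ (1 ⊗ₜ[O] a) y ∈ L := by
    obtain ⟨x, rfl⟩ := hy
    exact ⟨_, hjρ a x⟩
  have hP (y : V.carrier) (hy : y ∈ L) : V.parityOp y ∈ L := by
    obtain ⟨x, rfl⟩ := hy
    exact ⟨ε • ⟨γ x, hNγ x⟩, (hj _ _).trans (hjP x).symm⟩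
  let ρL : A →ₐ[O] Module.End O L := AlgHom.ofLinearMap
    { toFun := fun a => ((V.ρ (1 ⊗ₜ[O] a)).restrictScalars O).restrict (hρ a)
      map_add' := fun a a' => by
        ext y
        change V.ρ (1 ⊗ₜ[O] (a + a')) (y : V.carrier) =
          V.ρ (1 ⊗ₜ[O] a) (y : V.carrier) + V.ρ (1 ⊗ₜ[O] a') (y : V.carrier)
        rw [TensorProduct.tmul_add, map_add, LinearMap.add_apply]
      map_smul' := fun c a => by
        ext y
        simp only [TensorProduct.tmul_smul, LinearMap.coe_restrict_apply, RingHom.id_apply,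
          LinearMap.smul_apply, LinearMap.restrictScalars_apply, Submodule.coe_smul]
        rw [← algebraMap_smul F c ((1 : F) ⊗ₜ[O] a), map_smul]
        rfl }
    (by
      ext y
      simp [← Algebra.TensorProduct.one_def])
    (fun a a' => by
      ext y
      change V.ρ (1 ⊗ₜ[O] (a * a')) (y : V.carrier) =
        V.ρ (1 ⊗ₜ[O] a) (V.ρ (1 ⊗ₜ[O] a') (y : V.carrier))
      rw [← Module.End.mul_apply, ← map_mul, Algebra.TensorProduct.tmul_mul_tmul, one_mul])
  let PL : Module.End O L := (V.parityOp.restrictScalars O).restrict hP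
  refine ⟨⟨_, b.extendOfIsLattice F,
    ((LinearMap.toMatrixAlgEquiv b : Module.End O L ≃ₐ[O] _) : Module.End O L →ₐ[O] _).comp ρL,
    LinearMap.toMatrixAlgEquiv b PL,
    fun a => toMatrix_extendOfIsLattice b _ (ρL a) fun x => rfl,
    toMatrix_extendOfIsLattice b _ PL fun x => rfl⟩,
    b.equivFun.toLinearMap ∘ₗ j'.rangeRestrict,
    b.equivFun.surjective.comp j'.surjective_rangeRestrict,
    fun x i => repr_extendOfIsLattice b (j'.rangeRestrict x) i⟩

/-- Every simple module has an integral form. -/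
theorem exists_integralForm_of_isSimple (h2 : IsUnit (2 : O)) (hV : V.IsSimple)
    (hγ : IsParity 𝒜 γ) : Nonempty (IntegralForm V) := by
  have := hV.1
  -- The lattice is `A v` for a homogeneous `v`. The sign `ε` is the parity of `v`, which enters
  -- when `P` is moved past the action: `P (a v) = ε γ(a) v`.
  obtain ⟨v, ε, hv, hvP⟩ : ∃ (v : V.carrier) (ε : O), v ≠ 0 ∧
      V.parityOp v = algebraMap O F ε • v := by
    obtain ⟨v, hv⟩ := exists_ne (0 : V.carrier)
    obtain ⟨x, hx, y, hy, rfl⟩ := V.exists_add v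
    by_cases hx0 : x = 0
    · exact ⟨y, -1, by simpa [hx0] using hv, by simp [V.parityOp_odd hy]⟩
    · exact ⟨x, 1, hx0, by simp [V.parityOp_even hx]⟩
  have hP (a : F ⊗[O] A) : V.parityOp (V.ρ a v) = algebraMap O F ε •
      V.ρ (Algebra.TensorProduct.congr (AlgEquiv.refl : F ≃ₐ[F] F) γ a) v := by
    have := congrArg (fun g : Module.End F V.carrier => g v)
      (V.parityOp_mul_rho (hγ.baseChange F) a)
    simpa [hvP] using this
  have h2F : (2 : F) ≠ 0 := by
    have := (h2.map (algebraMap O F)).ne_zero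
    rwa [map_ofNat] at this
  let ev : F ⊗[O] A →ₗ[F] V.carrier := V.ρ.toLinearMap.flip v
  have hev (a : F ⊗[O] A) : ev a = V.ρ a v := rfl
  let j : (⊤ : Submodule O A) →+ V.carrier :=
    { toFun := fun a => ev ((1 : F) ⊗ₜ[O] (a : A))
      map_zero' := by simp
      map_add' := by simp [TensorProduct.tmul_add] }
  have hrange : LinearMap.range ev = ⊤ := by
    refine (hV.2 (LinearMap.range ev) ?_ (V.eq_sup_of_parityOp h2F ?_)).resolve_left fun h => ?_
    · rintro a _ ⟨x, rfl⟩
      exact ⟨a * x, by simp [hev]⟩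
    · rintro _ ⟨x, rfl⟩
      rw [hev, hP, ← hev, ← map_smul]
      exact ⟨_, rfl⟩
    · refine hv ?_
      have : ev 1 = v := by simp [hev]
      rw [← this]
      exact (Submodule.eq_bot_iff _).mp h _ ⟨_, rfl⟩
  obtain ⟨I, -⟩ := exists_integralForm (γ := γ) (V := V) ⊤ (fun _ _ => trivial) (fun _ => trivial) j
    (fun c x => by
      change ev (1 ⊗ₜ[O] (c • (x : A))) = algebraMap O F c • ev (1 ⊗ₜ[O] (x : A))
      rw [← map_smul, TensorProduct.tmul_smul, algebraMap_smul])
    (by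
      refine eq_top_iff.mpr (hrange ▸ ?_)
      rintro _ ⟨x, rfl⟩
      induction x using TensorProduct.induction_on with
      | zero => simp
      | add x y hx hy => rw [map_add]; exact add_mem hx hy
      | tmul d a =>
        rw [show d ⊗ₜ[O] a = d • ((1 : F) ⊗ₜ[O] a) by simp [TensorProduct.smul_tmul'], map_smul]
        exact Submodule.smul_mem _ _ (Submodule.subset_span ⟨⟨a, trivial⟩, rfl⟩))
    (fun a x => by
      change V.ρ (1 ⊗ₜ[O] (a * (x : A))) v = V.ρ _ (V.ρ _ v)
      rw [← Module.End.mul_apply, ← map_mul, Algebra.TensorProduct.tmul_mul_tmul, one_mul])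
    ε (fun x => by
      change V.parityOp (V.ρ (1 ⊗ₜ[O] (x : A)) v) = _
      rw [hP]
      simp [j, hev])
  exact ⟨I⟩

end

/-! ### Semisimple reduction forces the Schur elements to be units. -/

section Projective

variable {k : Type*} [Field k] {A : Type*} [Ring A] [Algebra k A] {t : A →ₗ[k] k}
  {σ : A →ₐ[k] A} {n : ℕ} {b : Module.Basis (Fin n) k A} {b' : Fin n → A}

/-- Over a semisimple algebra the identity of every module is an average. -/
theorem exists_average_eq_one [IsSemisimpleRing A] (ht : IsTwistedSymmetric t σ)
    (hd : IsDualBasis t b b') {X : Type*} [AddCommGroup X] [Module k X]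
    (ρ : A →ₐ[k] Module.End k X) : ∃ f : Module.End k X, average σ ρ b b' f = 1 := by
  let _ : Module A X := Module.compHom X (ρ : A →+* Module.End k X)
  have hsmul (a : A) (x : X) : a • x = ρ a x := rfl
  have : IsScalarTower k A X := ⟨fun c a x => by simp [hsmul]⟩
  obtain ⟨s, hs⟩ := (Module.projective_of_isSemisimpleRing A X).out
  -- The averaged operator is `τ ∘ s`, where `s` is an `A`-linear section of the canonical map from
  -- the free module and `τ` applies `t` to coefficients. Averaging `τ` recovers the canonical map,
  -- since `∑ t (a b) b^∨ = a`.
  let τ : (X →₀ A) →ₗ[k] X :=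
    Finsupp.linearCombination k id ∘ₗ Finsupp.mapRange.linearMap t
  have key (z : X →₀ A) : ∑ i, ρ (b' i) (τ (σ (b i) • z)) = Finsupp.linearCombination A id z := by
    induction z using Finsupp.induction_linear with
    | zero => simp
    | add x y hx hy => simp only [smul_add, map_add, Finset.sum_add_distrib, hx, hy]
    | single x a =>
      have h : ∀ i, t (σ (b i) * a) = t (a * b i) := fun i =>
        (ht.mul_map (b i) a).symm.trans (ht.symm a (b i)).symm
      simp only [Finsupp.smul_single, smul_eq_mul, τ, LinearMap.comp_apply,
        Finsupp.mapRange.linearMap_apply, Finsupp.mapRange_single, Finsupp.linearCombination_single,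
        id, h, map_smul]
      conv_rhs => rw [← hd.sum_smul_dual ht a, Finset.sum_smul]
      simp [hsmul]
  refine ⟨τ ∘ₗ s.restrictScalars k, LinearMap.ext fun v => ?_⟩
  rw [average, LinearMap.sum_apply]
  refine Eq.trans (Finset.sum_congr rfl fun i _ => ?_) ((key (s v)).trans (hs v))
  rw [← map_smul]
  rfl

end Projective

namespace IntegralForm

variable {O : Type u} [CommRing O] {F : Type v} [Field F] [Algebra O F]
  {A : Type w} [Ring A] [Algebra O A] {𝒜 : ZMod 2 → Submodule O A}
  {V : SuperModule (baseChange F 𝒜)} (I : IntegralForm V)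
  (S : Type*) [CommRing S] [Algebra O S]

/-- Reduction of the matrices along `O → S`. -/
noncomputable abbrev mapMatrix : Matrix (Fin I.rank) (Fin I.rank) O →ₐ[O]
    Matrix (Fin I.rank) (Fin I.rank) S := (Algebra.ofId O S).mapMatrix

theorem mapMatrix_smul_one (c : O) : I.mapMatrix S (c • 1) = algebraMap O S c • 1 := by
  rw [map_smul, map_one, algebraMap_smul]

/-- The matrix representation of `S ⊗ A`. -/
noncomputable def reduction : S ⊗[O] A →ₐ[S] Matrix (Fin I.rank) (Fin I.rank) S :=
  Algebra.TensorProduct.lift (Algebra.ofId S _) ((I.mapMatrix S).comp I.ρ)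
    (fun x _ => by rw [Algebra.ofId_apply]; exact Algebra.commutes x _)

theorem reduction_tmul (a : A) : I.reduction S (1 ⊗ₜ[O] a) = I.mapMatrix S (I.ρ a) := by
  rw [reduction, Algebra.TensorProduct.lift_tmul, map_one, one_mul]
  rfl

theorem mapMatrix_average {σ : A →ₐ[O] A} {n : ℕ} (b : Module.Basis (Fin n) O A) (b' : Fin n → A)
    (f : Matrix (Fin I.rank) (Fin I.rank) O) :
    I.mapMatrix S (average σ I.ρ b b' f) = average (baseChangeHom S σ) (I.reduction S)
      (b.baseChange S) (fun i => 1 ⊗ₜ[O] b' i) (I.mapMatrix S f) := by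
  simp only [average, map_sum, map_mul, Module.Basis.baseChange_apply,
    Algebra.TensorProduct.map_tmul, map_one, reduction_tmul]

variable [IsLocalRing O] [IsFractionRing O F]

open IsLocalRing in
/-- If the reduction of `A` is semisimple, then the Schur elements are units. -/
theorem residue_schur_ne_zero [IsSemisimpleRing (ResidueField O ⊗[O] A)] (hV : V.IsSimple)
    (h2 : IsUnit (2 : O)) {γ : A ≃ₐ[O] A} {σ : A →ₐ[O] A} {t : A →ₗ[O] O} {n : ℕ}
    {b : Module.Basis (Fin n) O A} {b' : Fin n → A}
    (hγ : IsParity 𝒜 γ) (ht : IsTwistedSymmetric t σ)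
    (hte : ∀ a ∈ 𝒜 1, t a = 0) (hσγ : ∀ x, σ (γ x) = γ (σ x)) (hd : IsDualBasis t b b')
    {u : Matrix (Fin I.rank) (Fin I.rank) O} {s : O}
    (hs : ∀ f, Commute I.P f → average σ I.ρ b b' f = (s * (u * f).trace) • 1) :
    residue O s ≠ 0 := by
  intro hs0
  obtain ⟨i, -⟩ := I.exists_index hV
  obtain ⟨g, hg⟩ := exists_average_eq_one (ht.baseChange (ResidueField O))
    (hd.baseChange (ResidueField O))
    ((Matrix.toLinAlgEquiv' : _ ≃ₐ[ResidueField O] _).toAlgHom.comp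
      (I.reduction (ResidueField O)))
  obtain ⟨g', rfl⟩ := (Matrix.toLinAlgEquiv' : _ ≃ₐ[ResidueField O] _).surjective g
  have hg' : average (baseChangeHom _ σ) (I.reduction (ResidueField O)) (b.baseChange _)
      (fun i => 1 ⊗ₜ[O] b' i) g' = 1 := by
    apply (Matrix.toLinAlgEquiv' : _ ≃ₐ[ResidueField O] _).injective
    rw [map_one, ← hg]
    rw [average, map_sum]
    exact Finset.sum_congr rfl fun i _ => by rw [map_mul, map_mul]; rfl
  choose r hr using residue_surjective (R := O)
  let f : Matrix (Fin I.rank) (Fin I.rank) O := g'.map r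
  have hf : I.mapMatrix (ResidueField O) f = g' := by
    ext i j
    exact hr _
  -- The operator whose average is `1` need not be even. Adding its conjugate by `P` makes it even
  -- and turns the average into `2`, still nonzero in the residue field.
  have hP : Commute I.P (f + I.P * f * I.P) := by
    rw [commute_iff_eq, mul_add, add_mul, mul_assoc I.P f, ← mul_assoc I.P I.P, I.P_mul_self,
      one_mul, mul_assoc I.P (f * I.P), mul_assoc f, I.P_mul_self, mul_one, add_comm]
  have h := congrArg (I.mapMatrix (ResidueField O)) (hs _ hP)
  rw [average_add, I.average_mul_P hγ ht hte hσγ hd, map_add, map_mul, map_mul,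
    I.mapMatrix_average, hf, hg', mul_one, ← map_mul, I.P_mul_self, map_one, mapMatrix_smul_one,
    map_mul, ResidueField.algebraMap_eq, hs0, zero_mul, zero_smul] at h
  have h' := congrFun (congrFun h i) i
  simp only [Matrix.add_apply, Matrix.one_apply_eq, Matrix.zero_apply] at h'
  rw [one_add_one_eq_two] at h'
  have := (h2.map (residue O)).ne_zero
  rw [map_ofNat] at this
  exact this h'

end IntegralForm

/-! ### Graded modules as modules over an algebra containing the parity operator. -/

section OfParity

variable {k : Type u} [Field k] {A : Type w} [Ring A] [Algebra k A]
  {𝒜 : ZMod 2 → Submodule k A} {γ : A ≃ₐ[k] A}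

theorem neg_one_pow_val_add {R : Type*} [CommRing R] (i j : ZMod 2) :
    (-1 : R) ^ (i + j).val = (-1) ^ i.val * (-1) ^ j.val := by
  have h : ∀ i : ZMod 2, i = 0 ∨ i = 1 := by decide
  have h11 : (1 + 1 : ZMod 2) = 0 := by decide
  obtain rfl | rfl := h i <;> obtain rfl | rfl := h j <;> simp [ZMod.val_one, h11]

theorem mem_ker_sub_smul_one {X : Type*} [AddCommGroup X] [Module k X] {P : Module.End k X} {c : k}
    {x : X} : x ∈ LinearMap.ker (P - c • (1 : Module.End k X)) ↔ P x = c • x := by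
  simp [sub_eq_zero]

/-- The supermodule structure on a representation with a compatible parity operator. -/
def SuperModule.ofParity (h2 : (2 : k) ≠ 0) (hγ : IsParity 𝒜 γ) (X : Type (max u w))
    [AddCommGroup X] [Module k X] [FiniteDimensional k X] (ρ : A →ₐ[k] Module.End k X)
    (P : Module.End k X) (hP : P * P = 1) (hPρ : ∀ a, P * ρ a = ρ (γ a) * P) :
    SuperModule 𝒜 where
  carrier := X
  part i := LinearMap.ker (P - ((-1 : k) ^ i.val) • 1)
  isInternal := by
    have hPP (x : X) : P (P x) = x := congrArg (fun g : Module.End k X => g x) hP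
    rw [DirectSum.isInternal_submodule_iff_isCompl _ (i := (0 : ZMod 2)) (j := 1) (by decide) (by
      ext i
      have : ∀ i : ZMod 2, i = 0 ∨ i = 1 := by decide
      simpa using this i)]
    refine ⟨Submodule.disjoint_def.mpr fun x h0 h1 => ?_,
      codisjoint_iff.mpr (eq_top_iff.mpr fun x _ => ?_)⟩
    · rw [mem_ker_sub_smul_one] at h0 h1
      rw [h0] at h1
      simp only [ZMod.val_zero, pow_zero, one_smul, ZMod.val_one, pow_one, neg_smul] at h1
      rw [← add_eq_zero_iff_eq_neg, ← two_smul k] at h1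
      exact (smul_eq_zero_iff_right h2).mp h1
    · refine Submodule.mem_sup.mpr ⟨(2 : k)⁻¹ • (x + P x), ?_, (2 : k)⁻¹ • (x - P x), ?_, ?_⟩
      · rw [mem_ker_sub_smul_one]
        simp [hPP, add_comm]
      · rw [mem_ker_sub_smul_one]
        simp [hPP, ZMod.val_one, ← smul_neg]
      · rw [← smul_add, add_add_sub_cancel, ← two_smul k x, smul_smul, inv_mul_cancel₀ h2, one_smul]
  ρ := ρ
  ρ_mem i j a ha v hv := by
    rw [mem_ker_sub_smul_one] at hv ⊢
    have h := congrArg (fun g : Module.End k X => g v) (hPρ a)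
    simp only [Module.End.mul_apply] at h
    rw [h, hv, hγ.apply_of_mem ha, neg_one_pow_val_add]
    simp [smul_smul, mul_comm]

theorem SuperModule.parityOp_ofParity (h2 : (2 : k) ≠ 0) (hγ : IsParity 𝒜 γ) (X : Type (max u w))
    [AddCommGroup X] [Module k X] [FiniteDimensional k X] (ρ : A →ₐ[k] Module.End k X)
    (P : Module.End k X) (hP : P * P = 1) (hPρ : ∀ a, P * ρ a = ρ (γ a) * P) :
    (SuperModule.ofParity h2 hγ X ρ P hP hPρ).parityOp = P := by
  refine LinearMap.ext fun v => ?_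
  obtain ⟨x, hx, y, hy, rfl⟩ := (SuperModule.ofParity h2 hγ X ρ P hP hPρ).exists_add v
  rw [map_add, SuperModule.parityOp_even _ hx, SuperModule.parityOp_odd _ hy]
  have hx' : P x = (-1 : k) ^ (0 : ZMod 2).val • (x : X) := mem_ker_sub_smul_one.mp hx
  have hy' : P y = (-1 : k) ^ (1 : ZMod 2).val • (y : X) := mem_ker_sub_smul_one.mp hy
  rw [ZMod.val_zero, pow_zero, one_smul] at hx'
  rw [ZMod.val_one, pow_one, neg_smul, one_smul] at hy'
  exact ((map_add P x y).trans (congrArg₂ (· + ·) hx' hy')).symm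

theorem SuperModule.parityOp_mem (V : SuperModule 𝒜) {W : Submodule k V.carrier}
    (hW : W = (W ⊓ V.part 0) ⊔ (W ⊓ V.part 1)) {w : V.carrier} (hw : w ∈ W) :
    V.parityOp w ∈ W := by
  rw [hW] at hw
  obtain ⟨x, hx, y, hy, rfl⟩ := Submodule.mem_sup.mp hw
  rw [map_add, V.parityOp_even hx.2, V.parityOp_odd hy.2]
  exact add_mem hx.1 (neg_mem hy.1)

theorem SuperModule.isSimple_ofParity (h2 : (2 : k) ≠ 0) (hγ : IsParity 𝒜 γ) (X : Type (max u w))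
    [AddCommGroup X] [Module k X] [FiniteDimensional k X] [Nontrivial X]
    (ρ : A →ₐ[k] Module.End k X)
    (P : Module.End k X) (hP : P * P = 1) (hPρ : ∀ a, P * ρ a = ρ (γ a) * P)
    (h : ∀ W : Submodule k X, (∀ a, ∀ w ∈ W, ρ a w ∈ W) → (∀ w ∈ W, P w ∈ W) → W = ⊥ ∨ W = ⊤) :
    (SuperModule.ofParity h2 hγ X ρ P hP hPρ).IsSimple := by
  refine ⟨‹_›, fun W hW hgr => h W hW fun w hw => ?_⟩
  have hm := SuperModule.parityOp_mem _ hgr hw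
  have e : (SuperModule.ofParity h2 hγ X ρ P hP hPρ).parityOp w = P w :=
    congrArg (fun g : Module.End k X => g w) (SuperModule.parityOp_ofParity h2 hγ X ρ P hP hPρ)
  exact e ▸ hm

end OfParity

section Crossed

variable (k : Type u) [Field k] {A : Type w} [Ring A] [Algebra k A] (γ : A ≃ₐ[k] A)

/-- The algebra of operators on `A` generated by the left multiplications and `γ`. Its submodules
of `A` are the left ideals stable under `γ`. -/
def crossedSubalgebra : Subalgebra k (Module.End k A) :=
  Algebra.adjoin k (Set.range (Algebra.lmul k A) ∪ {γ.toLinearMap})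

/-- The type of elements of `crossedSubalgebra`. -/
def CrossedAlgebra : Type w := crossedSubalgebra k γ

noncomputable instance : Ring (CrossedAlgebra k γ) :=
  inferInstanceAs (Ring (crossedSubalgebra k γ))

noncomputable instance : Algebra k (CrossedAlgebra k γ) :=
  inferInstanceAs (Algebra k (crossedSubalgebra k γ))

noncomputable instance : Module (CrossedAlgebra k γ) A :=
  inferInstanceAs (Module (crossedSubalgebra k γ) A)

instance : IsScalarTower k (CrossedAlgebra k γ) A :=
  inferInstanceAs (IsScalarTower k (crossedSubalgebra k γ) A)

/-- Left multiplication as an element of the crossed algebra. -/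
noncomputable def crossedLmul : A →ₐ[k] CrossedAlgebra k γ :=
  (Algebra.lmul k A).codRestrict (crossedSubalgebra k γ)
    fun a => Algebra.subset_adjoin (Or.inl ⟨a, rfl⟩)

/-- The automorphism `γ` as an element of the crossed algebra. -/
noncomputable def crossedParity : CrossedAlgebra k γ :=
  (⟨γ.toLinearMap, Algebra.subset_adjoin (Or.inr rfl)⟩ : crossedSubalgebra k γ)

variable {γ}

theorem crossedParity_mul_self (h : ∀ x, γ (γ x) = x) :
    crossedParity k γ * crossedParity k γ = 1 :=
  Subtype.ext (LinearMap.ext h)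

theorem crossedParity_mul_lmul (a : A) :
    crossedParity k γ * crossedLmul k γ a = crossedLmul k γ (γ a) * crossedParity k γ :=
  Subtype.ext (LinearMap.ext fun x => map_mul γ a x)

theorem crossedAlgebra_smul_mem {X : Type*} [AddCommGroup X] [Module k X]
    [Module (CrossedAlgebra k γ) X] [IsScalarTower k (CrossedAlgebra k γ) X] {W : Submodule k X}
    (h1 : ∀ a, ∀ w ∈ W, crossedLmul k γ a • w ∈ W) (h2 : ∀ w ∈ W, crossedParity k γ • w ∈ W)
    (e : CrossedAlgebra k γ) {w : X} (hw : w ∈ W) : e • w ∈ W := by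
  obtain ⟨e, he⟩ := e
  induction he using Algebra.adjoin_induction generalizing w with
  | mem x hx =>
    obtain ⟨a, rfl⟩ | rfl := hx
    · exact h1 a w hw
    · exact h2 w hw
  | algebraMap c =>
    have := W.smul_mem c hw
    rwa [← algebraMap_smul (CrossedAlgebra k γ) c w] at this
  | add x y hx hy hx' hy' =>
    let x' : CrossedAlgebra k γ := (⟨x, hx⟩ : crossedSubalgebra k γ)
    let y' : CrossedAlgebra k γ := (⟨y, hy⟩ : crossedSubalgebra k γ)
    change (x' + y') • w ∈ W
    rw [add_smul]
    exact add_mem (hx' hw) (hy' hw)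
  | mul x y hx hy hx' hy' =>
    let x' : CrossedAlgebra k γ := (⟨x, hx⟩ : crossedSubalgebra k γ)
    let y' : CrossedAlgebra k γ := (⟨y, hy⟩ : crossedSubalgebra k γ)
    change (x' * y') • w ∈ W
    rw [mul_smul]
    exact hx' (hy' hw)

variable {𝒜 : ZMod 2 → Submodule k A}

/-- The supermodule given by a module over the crossed algebra. -/
noncomputable def crossedSuperModule (h2 : (2 : k) ≠ 0) (hγ : IsParity 𝒜 γ) (X : Type (max u w))
    [AddCommGroup X] [Module k X] [FiniteDimensional k X] [Module (CrossedAlgebra k γ) X]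
    [IsScalarTower k (CrossedAlgebra k γ) X] : SuperModule 𝒜 :=
  SuperModule.ofParity h2 hγ X ((Algebra.lsmul k k X).comp (crossedLmul k γ))
    (Algebra.lsmul k k X (crossedParity k γ))
    (by rw [← map_mul, crossedParity_mul_self k hγ.involutive, map_one])
    (fun a => by
      simp only [AlgHom.comp_apply]
      rw [← map_mul, crossedParity_mul_lmul, map_mul])

theorem parityOp_crossedSuperModule (h2 : (2 : k) ≠ 0) (hγ : IsParity 𝒜 γ) (X : Type (max u w))
    [AddCommGroup X] [Module k X] [FiniteDimensional k X] [Module (CrossedAlgebra k γ) X]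
    [IsScalarTower k (CrossedAlgebra k γ) X] :
    (crossedSuperModule k h2 hγ X).parityOp = Algebra.lsmul k k X (crossedParity k γ) :=
  SuperModule.parityOp_ofParity h2 hγ X _ _ _ _

/-- Submodules over the crossed algebra are the `A`-stable subspaces preserved by parity, and graded
subspaces are of this kind. Ungraded module theory thus supplies simple supermodules. -/
theorem isSimple_crossedSuperModule (h2 : (2 : k) ≠ 0) (hγ : IsParity 𝒜 γ) (X : Type (max u w))
    [AddCommGroup X] [Module k X] [FiniteDimensional k X] [Module (CrossedAlgebra k γ) X]
    [IsScalarTower k (CrossedAlgebra k γ) X] [IsSimpleModule (CrossedAlgebra k γ) X] :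
    (crossedSuperModule k h2 hγ X).IsSimple := by
  have := IsSimpleModule.nontrivial (CrossedAlgebra k γ) X
  refine SuperModule.isSimple_ofParity h2 hγ X _ _ _ _ fun W hW hP => ?_
  let W' : Submodule (CrossedAlgebra k γ) X :=
    { W with smul_mem' := fun e w hw => crossedAlgebra_smul_mem k hW hP e hw }
  have := (isSimpleModule_iff (CrossedAlgebra k γ) X).mp inferInstance
  refine (eq_bot_or_eq_top W').imp (fun h => ?_) (fun h => ?_)
  · ext x
    exact (Submodule.ext_iff.mp h x)
  · ext x
    exact (Submodule.ext_iff.mp h x)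

end Crossed

/-! ### Simple graded subquotients and their lattices. -/

theorem exists_smul_eq_one_tmul {O : Type*} [CommRing O] [IsDomain O] {F : Type*} [Field F]
    [Algebra O F] [IsFractionRing O F] {A : Type*} [Ring A] [Algebra O A] (x : F ⊗[O] A) :
    ∃ (d : O) (a : A), d ≠ 0 ∧ algebraMap O F d • x = 1 ⊗ₜ[O] a := by
  induction x using TensorProduct.induction_on with
  | zero => exact ⟨1, 0, one_ne_zero, by simp⟩
  | add x y hx hy =>
    obtain ⟨d, a, hd, h⟩ := hx
    obtain ⟨d', a', hd', h'⟩ := hy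
    refine ⟨d * d', d' • a + d • a', mul_ne_zero hd hd', ?_⟩
    rw [smul_add, map_mul, mul_smul, mul_smul, h', smul_comm, h, TensorProduct.tmul_add,
      TensorProduct.tmul_smul, TensorProduct.tmul_smul, algebraMap_smul, algebraMap_smul]
  | tmul c a =>
    obtain ⟨n, d, hd, rfl⟩ := IsFractionRing.div_surjective (A := O) c
    have hd0 : d ≠ 0 := nonZeroDivisors.ne_zero hd
    have hd1 : algebraMap O F d ≠ 0 := by simpa using hd0
    refine ⟨d, n • a, hd0, ?_⟩
    rw [TensorProduct.smul_tmul', smul_eq_mul, mul_div_cancel₀ _ hd1, TensorProduct.tmul_smul,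
      TensorProduct.smul_tmul', Algebra.smul_def, mul_one]

/-- A condition on graded left ideals that holds for `0` and fails for the whole algebra is lost
between some graded left ideals `M ≤ N` with simple quotient. -/
theorem exists_simple_quotient {k : Type u} [Field k] {A : Type (max u w)} [Ring A] [Algebra k A]
    [FiniteDimensional k A] {𝒜 : ZMod 2 → Submodule k A} {γ : A ≃ₐ[k] A} (h2 : (2 : k) ≠ 0)
    (hγ : IsParity 𝒜 γ) (p : Submodule k A → Prop) (hbot : p ⊥) (htop : ¬ p ⊤) :
    ∃ (V : SuperModule 𝒜) (N : Submodule k A) (hN : ∀ (a : A) (x : N), a * x ∈ N)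
      (hNγ : ∀ x : N, γ x ∈ N) (π : N →ₗ[k] V.carrier), V.IsSimple ∧ Function.Surjective π ∧
      (∀ (a : A) (x : N), π ⟨a * x, hN a x⟩ = V.ρ a (π x)) ∧
      (∀ x : N, π ⟨γ x, hNγ x⟩ = V.parityOp (π x)) ∧
      p ((LinearMap.ker π).map N.subtype) ∧ ¬ p N := by
  let E := CrossedAlgebra k γ
  have : IsNoetherian E A := isNoetherian_of_tower k inferInstance
  have : IsArtinian E A := isArtinian_of_tower k inferInstance
  -- Take `M` maximal with the property and `N / M` a simple submodule of `A / M`; maximality makes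
  -- the property fail for `N`.
  obtain ⟨M, hM, hMmax⟩ := WellFounded.has_min (wellFounded_gt (α := Submodule E A))
    {M | p (M.restrictScalars k)} ⟨⊥, by simpa using hbot⟩
  have hMtop : M ≠ ⊤ := by
    rintro rfl
    exact htop (by simpa using hM)
  have : Nontrivial (A ⧸ M) := Submodule.Quotient.nontrivial_iff.mpr hMtop
  have : IsAtomic (Submodule E (A ⧸ M)) := isAtomic_of_orderBot_wellFounded_lt wellFounded_lt
  obtain ⟨X, hX, -⟩ := (IsAtomic.eq_bot_or_exists_atom_le
    (⊤ : Submodule E (A ⧸ M))).resolve_left top_ne_bot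
  have hXs : IsSimpleModule E X := isSimpleModule_iff_isAtom.mpr hX
  have : FiniteDimensional k X :=
    Module.Finite.of_injective (X.subtype.restrictScalars k) Subtype.val_injective
  let N := X.comap M.mkQ
  let π : N →ₗ[E] X := M.mkQ.restrict fun x hx => hx
  have hNE (e : E) (x : N.restrictScalars k) : e • (x : A) ∈ N := N.smul_mem e x.2
  have hker : (LinearMap.ker (π.restrictScalars k)).map (N.restrictScalars k).subtype =
      M.restrictScalars k := by
    ext x
    constructor
    · rintro ⟨y, hy, rfl⟩
      exact (Submodule.Quotient.mk_eq_zero M).mp (congrArg Subtype.val hy)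
    · intro hx
      have hx' : M.mkQ x = 0 := (Submodule.Quotient.mk_eq_zero M).mpr hx
      exact ⟨⟨x, (Submodule.mem_comap.mpr (hx' ▸ X.zero_mem) : x ∈ N)⟩, Subtype.ext hx', rfl⟩
  refine ⟨crossedSuperModule k h2 hγ X, N.restrictScalars k, fun a x => hNE (crossedLmul k γ a) x,
    fun x => hNE (crossedParity k γ) x, π.restrictScalars k,
    isSimple_crossedSuperModule k h2 hγ X, ?_, ?_, ?_, ?_, ?_⟩
  · rintro ⟨y, hy⟩
    obtain ⟨x, rfl⟩ := M.mkQ_surjective y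
    exact ⟨⟨x, hy⟩, rfl⟩
  · intro a x
    exact π.map_smul (crossedLmul k γ a) x
  · intro x
    refine Eq.trans (π.map_smul (crossedParity k γ) x) ?_
    exact (congrArg (fun g : Module.End k X => g (π x))
      (parityOp_crossedSuperModule k h2 hγ X)).symm
  · exact hker ▸ hM
  · intro hpN
    refine hMmax N hpN (lt_of_le_of_ne (fun x hx => ?_) fun h => hX.1 ?_)
    · have hx' : M.mkQ x = 0 := (Submodule.Quotient.mk_eq_zero M).mpr hx
      exact Submodule.mem_comap.mpr (hx' ▸ X.zero_mem)
    · refine (Submodule.eq_bot_iff _).mpr fun y hy => ?_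
      obtain ⟨x, rfl⟩ := M.mkQ_surjective y
      have hx : x ∈ N := hy
      rw [← h] at hx
      exact (Submodule.Quotient.mk_eq_zero M).mpr hx

section Subquotient

variable {O : Type u} [CommRing O] [IsDomain O] [IsPrincipalIdealRing O] {F : Type v} [Field F]
  [Algebra O F] [IsFractionRing O F] {A : Type w} [Ring A] [Algebra O A] [Module.Free O A]
  [Module.Finite O A] {𝒜 : ZMod 2 → Submodule O A} {γ : A ≃ₐ[O] A}

/-- A proper `O`-submodule `K` of `A` is avoided by a lattice in a simple graded subquotient of
`F ⊗ A`. -/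
theorem exists_simple_subquotient (h2 : (2 : F) ≠ 0) (hγ : IsParity 𝒜 γ) (K : Submodule O A)
    (hK : K ≠ ⊤) :
    ∃ (V : SuperModule (baseChange F 𝒜)) (I : IntegralForm V) (N : Submodule O A)
      (hN : ∀ (a : A) (x : N), a * x ∈ N) (hNγ : ∀ x : N, γ x ∈ N)
      (q : N →ₗ[O] (Fin I.rank → O)), V.IsSimple ∧ Function.Surjective q ∧
      (∀ (a : A) (x : N), q ⟨a * x, hN a x⟩ = (I.ρ a).mulVec (q x)) ∧
      (∀ x : N, q ⟨γ x, hNγ x⟩ = I.P.mulVec (q x)) ∧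
      (∀ x : N, q x = 0 → (x : A) ∈ K) ∧ ∃ x : N, (x : A) ∉ K := by
  have hinj : Function.Injective (Algebra.TensorProduct.includeRight : A →ₐ[O] F ⊗[O] A) :=
    Algebra.TensorProduct.includeRight_injective (IsFractionRing.injective O F)
  let ι : A →ₗ[O] F ⊗[O] A := Algebra.TensorProduct.includeRight.toLinearMap
  have hι (a : A) : ι a = 1 ⊗ₜ[O] a := rfl
  obtain ⟨V, N', hN', hN'γ, π, hV, hπ, hπρ, hπP, hM, hN⟩ :=
    -- The condition on a graded left ideal of `F ⊗ A` is that its intersection with `A` lies in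
    -- `K`.
    exists_simple_quotient.{v, w} h2 (hγ.baseChange F)
      (fun M => ∀ a : A, ι a ∈ M → a ∈ K)
      (fun a ha => by
        have : a = 0 := hinj (by simpa [ι] using ha)
        rw [this]
        exact zero_mem K)
      (fun h => hK (eq_top_iff.mpr fun a _ => h a trivial))
  let N : Submodule O A := (N'.restrictScalars O).comap ι
  have hNι (a : A) (x : N) : a * (x : A) ∈ N := by
    have := hN' (ι a) ⟨ι x, x.2⟩
    have e : ι (a * x) = ι a * ι x := by simp [hι]
    change ι (a * x) ∈ N'
    rw [e]
    exact this
  have hNγ (x : N) : γ (x : A) ∈ N := hN'γ ⟨ι x, x.2⟩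
  let j : N →+ V.carrier :=
    { toFun := fun x => π ⟨ι x, x.2⟩
      map_zero' := by
        rw [← map_zero π]
        congr 1
        exact Subtype.ext (map_zero ι)
      map_add' := fun x y => by
        rw [← map_add π]
        congr 1
        exact Subtype.ext (map_add ι _ _) }
  obtain ⟨I, q, hq, hqj⟩ := exists_integralForm N hNι hNγ j
    (fun c x => by
      change π ⟨ι (c • (x : A)), _⟩ = algebraMap O F c • π ⟨ι x, x.2⟩
      rw [← map_smul π]
      congr 1
      refine Subtype.ext ?_
      change ι (c • (x : A)) = algebraMap O F c • ι x
      rw [map_smul, algebraMap_smul])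
    (by
      refine eq_top_iff.mpr fun v _ => ?_
      obtain ⟨⟨x, hx⟩, rfl⟩ := hπ v
      obtain ⟨d, a, hd, ha⟩ := exists_smul_eq_one_tmul x
      have hd' : algebraMap O F d ≠ 0 := by simpa using hd
      have haN : ι a ∈ N' := by
        rw [hι, ← ha]
        exact N'.smul_mem _ hx
      have h : π ⟨x, hx⟩ = (algebraMap O F d)⁻¹ • j ⟨a, haN⟩ := by
        change _ = (algebraMap O F d)⁻¹ • π ⟨ι a, haN⟩
        rw [eq_inv_smul_iff₀ hd', ← map_smul π]
        congr 1
        exact Subtype.ext ha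
      rw [h]
      exact Submodule.smul_mem _ _ (Submodule.subset_span ⟨_, rfl⟩))
    (fun a x => by
      rw [← hι]
      refine Eq.trans ?_ (hπρ (ι a) ⟨ι x, x.2⟩)
      change π ⟨ι (a * x), _⟩ = _
      congr 1
      exact Subtype.ext (by simp [hι]))
    1 (fun x => by
      rw [map_one, one_smul]
      exact (hπP ⟨ι x, x.2⟩).symm)
  have hjρ (a : A) (x : N) : j ⟨a * x, hNι a x⟩ = V.ρ (1 ⊗ₜ[O] a) (j x) := by
    rw [← hι]
    refine Eq.trans ?_ (hπρ (ι a) ⟨ι x, x.2⟩)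
    change π ⟨ι (a * x), _⟩ = _
    congr 1
    exact Subtype.ext (by simp [hι])
  have hjP (x : N) : j ⟨γ x, hNγ x⟩ = V.parityOp (j x) := hπP ⟨ι x, x.2⟩
  have hrepr (x : N) : I.basis.repr (j x) = fun i => algebraMap O F (q x i) :=
    funext (hqj x)
  have hmat (g : Module.End F V.carrier) (g' : Matrix (Fin I.rank) (Fin I.rank) O)
      (hg : LinearMap.toMatrixAlgEquiv I.basis g = g'.map (algebraMap O F)) (x y : N)
      (hxy : j y = g (j x)) : q y = g'.mulVec (q x) := by
    funext i
    apply IsFractionRing.injective O F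
    rw [← hqj, hxy, ← LinearMap.toMatrix_mulVec_repr I.basis I.basis g]
    change ((LinearMap.toMatrixAlgEquiv I.basis g).mulVec _) i = _
    rw [hg, hrepr]
    simp [Matrix.mulVec, dotProduct]
  have hN2 : ∃ x : N, (x : A) ∉ K := by
    by_contra! h
    exact hN fun a ha => h ⟨a, ha⟩
  refine ⟨V, I, N, hNι, hNγ, q, hV, hq, fun a x => hmat _ _ (I.toMatrix_ρ a) _ _ (hjρ a x),
    fun x => hmat _ _ I.toMatrix_parityOp _ _ (hjP x), fun x hx => ?_, hN2⟩
  have hjx : j x = 0 := by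
    apply I.basis.repr.injective
    ext i
    rw [hqj, hx]
    simp
  exact hM x ⟨⟨ι x, x.2⟩, hjx, rfl⟩

end Subquotient

/-! ### Unit Schur elements force semisimple reduction. -/

/-- An element `z` fixed by right multiplication with an element of the radical is zero. -/
theorem eq_zero_of_mul_mem_jacobson {B : Type*} [Ring B] [IsArtinianRing B] {z j : B}
    (hj : j ∈ Ring.jacobson B) (h : z * j = z) : z = 0 := by
  obtain ⟨n, hn⟩ := IsSemiprimaryRing.isNilpotent (R := B)
  have hjn : j ^ n = 0 := by
    have := Ideal.pow_mem_pow hj n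
    rwa [hn] at this
  have hz : ∀ m : ℕ, z * j ^ m = z := fun m => by
    induction m with
    | zero => simp
    | succ m ih => rw [pow_succ', ← mul_assoc, h, ih]
  rw [← hz n, hjn, mul_zero]

theorem map_mem_jacobson {k B : Type*} [CommRing k] [Ring B] [Algebra k B] (γ : B ≃ₐ[k] B) {x : B}
    (hx : x ∈ Ring.jacobson B) : γ x ∈ Ring.jacobson B := by
  have : RingHomSurjective (γ : B →+* B) := ⟨γ.surjective⟩
  exact Ring.le_comap_jacobson (γ : B →+* B) hx

section Reduction

open IsLocalRing

variable {O : Type u} [CommRing O] [IsDomain O] [IsDiscreteValuationRing O] {F : Type v} [Field F]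
  [Algebra O F] [IsFractionRing O F] {A : Type w} [Ring A] [Algebra O A]
  {𝒜 : ZMod 2 → Submodule O A} {γ : A ≃ₐ[O] A}
  {σ : A →ₐ[O] A} {t : A →ₗ[O] O} {n : ℕ} {b : Module.Basis (Fin n) O A} {b' : Fin n → A}

/-- A lattice whose averages are given by a unit is irreducible modulo the maximal ideal. -/
theorem IntegralForm.eq_top_of_isUnit {V : SuperModule (baseChange F 𝒜)} (I : IntegralForm V)
    (h2 : IsUnit (2 : O)) {u : Matrix (Fin I.rank) (Fin I.rank) O} (hu : u = 1 ∨ u = I.P) {s : O}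
    (hs : IsUnit s) (havg : ∀ f, Commute I.P f → average σ I.ρ b b' f = (s * (u * f).trace) • 1)
    (K : Submodule O (Fin I.rank → O)) (hKρ : ∀ a, ∀ y ∈ K, (I.ρ a).mulVec y ∈ K)
    (hKP : ∀ y ∈ K, I.P.mulVec y ∈ K) {y : Fin I.rank → O} (hy : y ∈ K) {i : Fin I.rank}
    (hi : IsUnit (y i)) : K = ⊤ := by
  obtain ⟨e, he, heK, h1, hP⟩ := exists_even_rank_one h2 I.P_mul_self K hKP hy hi
  have hue : IsUnit (u * e).trace := by
    obtain rfl | rfl := hu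
    · rwa [one_mul]
    · exact hP
  obtain ⟨r, hr⟩ := hs.mul hue
  refine eq_top_iff.mpr fun c _ => ?_
  -- The image of `e` lies in the stable submodule `K`, hence so does that of its average, which is
  -- a unit scalar.
  have hc : (average σ I.ρ b b' e).mulVec c ∈ K := by
    rw [average, Matrix.sum_mulVec]
    refine sum_mem fun l _ => ?_
    rw [← Matrix.mulVec_mulVec, ← Matrix.mulVec_mulVec]
    exact hKρ _ _ (heK _)
  rw [havg e he, Matrix.smul_mulVec, Matrix.one_mulVec, ← hr] at hc
  exact (K.smul_mem_iff' r).mp hc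

variable [Module.Finite O A]

/-- The reduction of a lattice with unit Schur element does not embed into the radical. -/
theorem IntegralForm.false_of_injective {V : SuperModule (baseChange F 𝒜)} (I : IntegralForm V)
    {k : Type*} [Field k] [Algebra O k] (hV : V.IsSimple)
    (h2 : IsUnit (2 : O)) (ht : IsTwistedSymmetric t σ) (hd : IsDualBasis t b b')
    {u : Matrix (Fin I.rank) (Fin I.rank) O} (hu : u = 1 ∨ u = I.P) {s : O}
    (hs : IsUnit s) (havg : ∀ f, Commute I.P f → average σ I.ρ b b' f = (s * (u * f).trace) • 1)
    (θ : (Fin I.rank → k) →ₗ[k] k ⊗[O] A) (hθinj : LinearMap.ker θ = ⊥)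
    (hθJ : ∀ c, θ c ∈ Ring.jacobson (k ⊗[O] A))
    (hθρ : ∀ a c, θ ((I.mapMatrix k (I.ρ a)).mulVec c) = 1 ⊗ₜ[O] a * θ c) : False := by
  have : IsArtinianRing (k ⊗[O] A) := isArtinian_of_tower k inferInstance
  obtain ⟨r, hr⟩ := θ.exists_leftInverse_of_injective hθinj
  have hrθ (c) : r (θ c) = c := congrArg (fun g => g c) hr
  obtain ⟨e, he, hue⟩ := I.exists_even_isUnit_trace h2 hV hu
  -- The rank-one operator transported to the regular module along `θ` and a merely linear
  -- retraction `r`. Its average commutes with left multiplications, so it is right multiplication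
  -- by its value at `1`, which lies in the radical.
  let G : Module.End k (k ⊗[O] A) := θ ∘ₗ (I.mapMatrix k e).mulVecLin ∘ₗ r
  let g : Module.End k (k ⊗[O] A) := average (baseChangeHom k σ) (Algebra.lmul k (k ⊗[O] A))
    (b.baseChange k) (fun i => 1 ⊗ₜ[O] b' i) G
  have hgmul (y : k ⊗[O] A) : g y = y * g 1 := by
    have h := commute_average (Algebra.lmul k (k ⊗[O] A)) (ht.baseChange k) (hd.baseChange k) G y
    have := congrArg (fun f : Module.End k (k ⊗[O] A) => f 1) h.eq
    simpa [g] using this.symm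
  have hgapply (y : k ⊗[O] A) : g y = ∑ i, 1 ⊗ₜ[O] b' i * θ ((I.mapMatrix k e).mulVec
      (r (1 ⊗ₜ[O] σ (b i) * y))) := by
    simp [g, G, average, LinearMap.sum_apply]
  have hg1 : g 1 ∈ Ring.jacobson (k ⊗[O] A) := by
    rw [hgapply]
    exact sum_mem fun i _ => Ideal.mul_mem_left _ _ (hθJ _)
  -- On the copy of the reduced lattice `r` inverts `θ`, so `g` acts there as the average of `e`, a
  -- nonzero scalar.
  have hgθ (c) : g (θ c) = algebraMap O k (s * (u * e).trace) • θ c := by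
    have h := congrArg (fun M => (I.mapMatrix k M).mulVec c) (havg e he)
    simp only [average, map_sum, map_mul _ (_ * _) _, map_mul _ (I.ρ _) _, I.mapMatrix_smul_one,
      Matrix.sum_mulVec] at h
    rw [Matrix.smul_mulVec, Matrix.one_mulVec] at h
    rw [hgapply, ← map_smul, ← h, map_sum]
    refine Finset.sum_congr rfl fun i _ => ?_
    rw [← hθρ, ← hθρ, hrθ, Matrix.mulVec_mulVec, Matrix.mulVec_mulVec]
  have hres : algebraMap O k (s * (u * e).trace) ≠ 0 := ((hs.mul hue).map (algebraMap O k)).ne_zero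
  obtain ⟨i, -⟩ := I.exists_index hV
  have hz0 : θ (Pi.single i 1) = 0 := by
    refine eq_zero_of_mul_mem_jacobson (j := (algebraMap O k (s * (u * e).trace))⁻¹ • g 1) ?_ ?_
    · rw [Algebra.smul_def]
      exact Ideal.mul_mem_left _ _ hg1
    · rw [mul_smul_comm, ← hgmul, hgθ, smul_smul, inv_mul_cancel₀ hres, one_smul]
  have hz1 := congrFun (LinearMap.ker_eq_bot'.mp hθinj _ hz0) i
  simp at hz1

variable [Module.Free O A]

/-- If all Schur elements are units, then the reduction of `A` is semisimple. -/
theorem jacobson_eq_bot (h2 : IsUnit (2 : O)) (hγ : IsParity 𝒜 γ) (ht : IsTwistedSymmetric t σ)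
    (hd : IsDualBasis t b b')
    (H : ∀ V : SuperModule (baseChange F 𝒜), V.IsSimple → ∀ I : IntegralForm V,
      ∃ (u : Matrix (Fin I.rank) (Fin I.rank) O) (s : O), (u = 1 ∨ u = I.P) ∧ residue O s ≠ 0 ∧
        ∀ f, Commute I.P f → average σ I.ρ b b' f = (s * (u * f).trace) • 1) :
    Ring.jacobson (ResidueField O ⊗[O] A) = ⊥ := by
  by_contra hJ
  have : IsArtinianRing (ResidueField O ⊗[O] A) :=
    isArtinian_of_tower (ResidueField O) inferInstance
  let γk : (ResidueField O ⊗[O] A) ≃ₐ[ResidueField O] (ResidueField O ⊗[O] A) :=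
    Algebra.TensorProduct.congr AlgEquiv.refl γ
  have hγk : IsParity (baseChange (ResidueField O) 𝒜) γk := hγ.baseChange (ResidueField O)
  have h2k : (2 : ResidueField O) ≠ 0 := by
    have := (h2.map (residue O)).ne_zero
    rwa [map_ofNat] at this
  have h2F : (2 : F) ≠ 0 := by
    have := (h2.map (algebraMap O F)).ne_zero
    rwa [map_ofNat] at this
  -- The radical is stable under parity, so either `x + γ x` is a nonzero even element of it or `x`
  -- is odd. Homogeneity of `w` makes its annihilator `K` stable under `γ`.
  obtain ⟨w, hwJ, hw0, hw⟩ : ∃ w ∈ Ring.jacobson (ResidueField O ⊗[O] A), w ≠ 0 ∧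
      (γk w = w ∨ γk w = -w) := by
    obtain ⟨x, hx, hx0⟩ := Submodule.exists_mem_ne_zero_of_ne_bot hJ
    have hγx : γk x ∈ Ring.jacobson (ResidueField O ⊗[O] A) := map_mem_jacobson γk hx
    by_cases h : x + γk x = 0
    · exact ⟨x, hx, hx0, Or.inr (eq_neg_of_add_eq_zero_right h)⟩
    · exact ⟨x + γk x, add_mem hx hγx, h, Or.inl (by rw [map_add, hγk.involutive, add_comm])⟩
  let ι' : A →ₐ[O] (ResidueField O ⊗[O] A) := Algebra.TensorProduct.includeRight
  let ι : A →ₗ[O] (ResidueField O ⊗[O] A) := ι'.toLinearMap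
  have hι1 : ι 1 = 1 := map_one ι'
  have hιmul (x y : A) : ι (x * y) = ι x * ι y := map_mul ι' x y
  have hιγ (x : A) : ι (γ x) = γk (ι x) := by simp [ι, ι', γk]
  let K : Submodule O A := LinearMap.ker (LinearMap.mulRight O w ∘ₗ ι)
  have hK (x : A) : x ∈ K ↔ ι x * w = 0 := Iff.rfl
  have hKtop : K ≠ ⊤ := fun h => hw0 <| by
    have : (1 : A) ∈ K := h ▸ trivial
    rwa [hK, hι1, one_mul] at this
  have hKγ (x : A) (hx : x ∈ K) : γ x ∈ K := by
    rw [hK] at hx ⊢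
    have : γk (ι x * w) = 0 := by rw [hx, map_zero]
    rw [map_mul] at this
    rw [hιγ]
    obtain h | h := hw
    · rwa [h] at this
    · rwa [h, mul_neg, neg_eq_zero] at this
  obtain ⟨V, I, N, hN, hNγ, q, hV, hq, hqρ, hqP, hqK, x₀, hx₀⟩ :=
    exists_simple_subquotient (F := F) h2F hγ K hKtop
  obtain ⟨u, s, hu, hs0, hs⟩ := H V hV I
  have hsu : IsUnit s := by
    by_contra h
    exact hs0 ((residue_eq_zero_iff s).mpr ((mem_maximalIdeal s).mpr h))
  -- Since `ker q` lies in `K`, a vector `q x` lies in `T` only if `x` is in `K`, so `T` is proper.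
  -- Irreducibility then puts `T` inside the maximal ideal times the lattice.
  let T : Submodule O (Fin I.rank → O) := (K.comap N.subtype).map q
  have hT (x : N) (hx : q x ∈ T) : (x : A) ∈ K := by
    obtain ⟨y, hy, hyx⟩ := hx
    have := hqK (x - y) (by rw [map_sub, hyx, sub_self])
    have h := add_mem this (show (y : A) ∈ K from hy)
    simpa using h
  have hTunit (y : Fin I.rank → O) (hy : y ∈ T) (i : Fin I.rank) : ¬ IsUnit (y i) := by
    intro hi
    have hTtop : T = ⊤ := by
      refine I.eq_top_of_isUnit h2 hu hsu hs T ?_ ?_ hy hi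
      · rintro a _ ⟨x, hx, rfl⟩
        refine ⟨⟨a * x, hN a x⟩, ?_, hqρ a x⟩
        change ι (a * x) * w = 0
        rw [hιmul, mul_assoc, show ι x * w = 0 from hx, mul_zero]
      · rintro _ ⟨x, hx, rfl⟩
        exact ⟨⟨γ x, hNγ x⟩, hKγ x hx, hqP x⟩
    exact hx₀ (hT x₀ (hTtop ▸ trivial))
  let red (c : Fin I.rank → O) : Fin I.rank → (ResidueField O) := fun i => residue O (c i)
  have hred (c : Fin I.rank → ResidueField O) : ∃ x : N, red (q x) = c := by
    choose r hr using residue_surjective (R := O)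
    obtain ⟨x, hx⟩ := hq fun i => r (c i)
    exact ⟨x, by rw [hx]; exact funext fun i => hr (c i)⟩
  choose x hx using fun i => hq (Pi.single i 1)
  let θ : (Fin I.rank → ResidueField O) →ₗ[ResidueField O] (ResidueField O ⊗[O] A) :=
    Fintype.linearCombination (ResidueField O) fun i => ι (x i) * w
  -- Modulo `ker q ⊆ K`, `y` is the combination of the lifts `x i` with coefficients `q y i`, so
  -- multiplication by `w` depends only on the reduction of `q y`.
  have hθ (y : N) : θ (red (q y)) = ι y * w := by
    have hy : q (y - ∑ i, q y i • x i) = 0 := by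
      simp only [map_sub, map_sum, map_smul, hx]
      rw [sub_eq_zero]
      exact pi_eq_sum_univ' (q y) |>.trans (by simp)
    have hyK := (hK _).mp (hqK _ hy)
    simp only [AddSubgroupClass.coe_sub, Submodule.coe_sum, Submodule.coe_smul, map_sub, map_sum,
      map_smul, sub_mul, Finset.sum_mul, sub_eq_zero, smul_mul_assoc] at hyK
    rw [hyK, Fintype.linearCombination_apply]
    rfl
  have hredmul (M : Matrix (Fin I.rank) (Fin I.rank) O) (c : Fin I.rank → O) :
      (I.mapMatrix (ResidueField O) M).mulVec (red c) = red (M.mulVec c) := by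
    funext i
    simp only [Matrix.mulVec, dotProduct, red, map_sum, map_mul]
    rfl
  have hθρ (a : A) (c : Fin I.rank → ResidueField O) :
      θ ((I.mapMatrix (ResidueField O) (I.ρ a)).mulVec c) = ι a * θ c := by
    obtain ⟨y, rfl⟩ := hred c
    rw [hredmul, ← hqρ, hθ, hθ, hιmul, mul_assoc]
  have hθJ (c : Fin I.rank → ResidueField O) : θ c ∈ Ring.jacobson (ResidueField O ⊗[O] A) := by
    obtain ⟨y, rfl⟩ := hred c
    rw [hθ]
    exact Ideal.mul_mem_left _ _ hwJ
  -- If the class of `q y` is killed, then `y` is in `K` and `q y` is in `T`, so all its coordinates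
  -- are non-units and reduce to zero.
  have hθinj : LinearMap.ker θ = ⊥ := by
    refine LinearMap.ker_eq_bot'.mpr fun c hc => ?_
    obtain ⟨y, rfl⟩ := hred c
    rw [hθ] at hc
    funext i
    have := hTunit (q y) ⟨y, hc, rfl⟩ i
    exact (residue_eq_zero_iff _).mpr ((mem_maximalIdeal _).mpr this)
  exact I.false_of_injective hV h2 ht hd hu hsu hs θ hθinj hθJ hθρ

end Reduction

theorem isUnit_two_of_ringChar_ne_two {O : Type u} [CommRing O] [IsLocalRing O]
    (h : ringChar (IsLocalRing.ResidueField O) ≠ 2) : IsUnit (2 : O) := by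
  rw [← IsLocalRing.residue_ne_zero_iff_isUnit, map_ofNat]
  exact Ring.two_ne_zero h

theorem isSemisimple_iff_isSemisimpleRing {k : Type u} [Field k] {A : Type w} [Ring A]
    [Algebra k A] [Module.Finite k A] : IsSemisimple A ↔ IsSemisimpleRing A := by
  have : IsArtinianRing A := isArtinian_of_tower k inferInstance
  exact IsArtinianRing.isSemisimpleRing_iff_jacobson.symm

end SuperAlg

/-! ### The two cases of the criterion. -/

open SuperAlg

theorem theorem1p1 {O : Type u} [CommRing O] [IsDomain O] [IsDiscreteValuationRing O]
    (hchar : ringChar (IsLocalRing.ResidueField O) ≠ 2)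
    {F : Type v} [Field F] [Algebra O F] [IsFractionRing O F]
    {A : Type w} [Ring A] [Algebra O A] [Module.Free O A] [Module.Finite O A]
    (𝒜 : ZMod 2 → Submodule O A) [GradedAlgebra 𝒜]
    (t : A →ₗ[O] O)
    (hsplit : SuperAlg.IsSplit (SuperAlg.baseChange (IsLocalRing.ResidueField O) 𝒜))
    (hsplit' : SuperAlg.IsSplit (SuperAlg.baseChange F 𝒜)) :
    -- the symmetric case: Schur elements exist, are unique and integral; the criterion
    (SuperAlg.IsSymmetrizingForm 𝒜 t →
      (∀ V : SuperAlg.SuperModule (SuperAlg.baseChange F 𝒜), V.IsSimple →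
        ∃ a : O, ∀ s : F, V.IsSchurElement (SuperAlg.baseChangeForm F t) s ↔ s = algebraMap O F a) ∧
      (SuperAlg.IsSemisimple (IsLocalRing.ResidueField O ⊗[O] A) ↔
        ∀ V : SuperAlg.SuperModule (SuperAlg.baseChange F 𝒜), V.IsSimple →
          ∀ a : O, V.IsSchurElement (SuperAlg.baseChangeForm F t) (algebraMap O F a) →
            IsLocalRing.residue O a ≠ 0)) ∧
    -- the supersymmetric case, where Schur elements are attached to simple modules of type `M`
    (SuperAlg.IsSupersymmetrizingForm 𝒜 t →
      (∀ V : SuperAlg.SuperModule (SuperAlg.baseChange F 𝒜), V.IsSimple → V.IsTypeM →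
        ∃ a : O, ∀ s : F,
          V.IsSuperSchurElement (SuperAlg.baseChangeForm F t) s ↔ s = algebraMap O F a) ∧
      (SuperAlg.IsSemisimple (IsLocalRing.ResidueField O ⊗[O] A) ↔
        (∀ V : SuperAlg.SuperModule (SuperAlg.baseChange F 𝒜), V.IsSimple → V.IsTypeM →
          ∀ a : O, V.IsSuperSchurElement (SuperAlg.baseChangeForm F t) (algebraMap O F a) →
            IsLocalRing.residue O a ≠ 0) ∧
        (∀ V : SuperAlg.SuperModule (SuperAlg.baseChange F 𝒜), V.IsSimple → V.IsTypeM))) := by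
  have h2 : IsUnit (2 : O) := isUnit_two_of_ringChar_ne_two hchar
  have hγ := isParity_parity 𝒜
  have hinj : Function.Injective (algebraMap O F) := IsFractionRing.injective O F
  refine ⟨fun h => ?_, fun h => ?_⟩
  · obtain ⟨n, b, p, hb, hdet⟩ := h.nondegenerate
    obtain ⟨b', hd⟩ := exists_isDualBasis b hdet
    have ht := h.isTwistedSymmetric
    have schur (V : SuperModule (baseChange F 𝒜)) (hV : V.IsSimple) (I : IntegralForm V) :
        ∃ s : O, ∀ f, Commute I.P f →
          average (AlgHom.id O A) I.ρ b b' f = (s * (1 * f).trace) • 1 :=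
      I.exists_schur hV (hsplit' V hV _) h2 hγ ht h.even (fun _ => rfl) hd (Or.inl rfl)
        (fun a => by simp)
    refine ⟨fun V hV => ?_, fun hss V hV a ha => ?_, fun H => ?_⟩
    · obtain ⟨I⟩ := exists_integralForm_of_isSimple h2 hV hγ
      obtain ⟨s, hs⟩ := schur V hV I
      exact ⟨s, I.isSchurElement_iff h2 hV ht hd hb hs⟩
    · obtain ⟨I⟩ := exists_integralForm_of_isSimple h2 hV hγ
      obtain ⟨s, hs⟩ := schur V hV I
      have := (isSemisimple_iff_isSemisimpleRing (k := IsLocalRing.ResidueField O)).mp hss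
      rw [hinj ((I.isSchurElement_iff h2 hV ht hd hb hs _).mp ha)]
      exact I.residue_schur_ne_zero hV h2 hγ ht h.even (fun _ => rfl) hd hs
    · refine jacobson_eq_bot (F := F) h2 hγ ht hd fun V hV I => ?_
      obtain ⟨s, hs⟩ := schur V hV I
      exact ⟨1, s, Or.inl rfl, H V hV s ((I.isSchurElement_iff h2 hV ht hd hb hs _).mpr rfl), hs⟩
  · obtain ⟨n, b, p, hb, hdet⟩ := h.nondegenerate
    obtain ⟨b', hd⟩ := exists_isDualBasis b hdet
    have ht := h.isTwistedSymmetric hγ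
    have schur (V : SuperModule (baseChange F 𝒜)) (hV : V.IsSimple) (I : IntegralForm V) :
        ∃ s : O, ∀ f, Commute I.P f →
          average (parity 𝒜 : A →ₐ[O] A) I.ρ b b' f = (s * (I.P * f).trace) • 1 :=
      I.exists_schur hV (hsplit' V hV _) h2 hγ ht h.even (fun _ => rfl) hd (Or.inr rfl)
        (I.P_mul_ρ hγ)
    refine ⟨fun V hV _ => ?_, fun hss => ?_, fun ⟨H, hM⟩ => ?_⟩
    · obtain ⟨I⟩ := exists_integralForm_of_isSimple h2 hV hγ
      obtain ⟨s, hs⟩ := schur V hV I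
      exact ⟨s, I.isSuperSchurElement_iff h2 hV hγ ht hd hb hs⟩
    · have := (isSemisimple_iff_isSemisimpleRing (k := IsLocalRing.ResidueField O)).mp hss
      have hne (V : SuperModule (baseChange F 𝒜)) (hV : V.IsSimple) :
          V.IsTypeM ∧ ∀ a : O, V.IsSuperSchurElement (baseChangeForm F t) (algebraMap O F a) →
            IsLocalRing.residue O a ≠ 0 := by
        obtain ⟨I⟩ := exists_integralForm_of_isSimple h2 hV hγ
        obtain ⟨s, hs⟩ := schur V hV I
        have hs0 := I.residue_schur_ne_zero hV h2 hγ ht h.even (fun _ => rfl) hd hs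
        -- The nonvanishing of the reduced scalar `s` was proved for every simple module; outside
        -- type `M` it would contradict `s = 0`.
        refine ⟨by_contra fun hM => hs0 ?_, fun a ha => ?_⟩
        · rw [I.schur_eq_zero hV (hsplit' V hV _) h2 hγ ht h.even hd hs hM, map_zero]
        · rwa [hinj ((I.isSuperSchurElement_iff h2 hV hγ ht hd hb hs _).mp ha)]
      exact ⟨fun V hV _ => (hne V hV).2, fun V hV => (hne V hV).1⟩
    · refine jacobson_eq_bot (F := F) h2 hγ ht hd fun V hV I => ?_
      obtain ⟨s, hs⟩ := schur V hV I
      exact ⟨I.P, s, Or.inr rfl, H V hV (hM V hV) s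
        ((I.isSuperSchurElement_iff h2 hV hγ ht hd hb hs _).mpr rfl), hs⟩
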